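/- Let $E=\mathbb R^n$ with a norm $\|\cdot\|$, let $\mathcal C\subset E$ be a nonempty polytope with vertex set $\mathrm{Ext}(\mathcal C)$, and let $f:E\to\mathbb R$ be convex and differentiable with Lipschitz gradient on $\mathcal C+(\mathcal C-\mathcal C)$. Let $X^*$ be the set of minimizers of $f$ over $\mathcal C$ and $f^*=\min_{\mathcal C}f$. **Definitions.** For $x\in\mathcal C$ and a proper support $S$ of $x$ (a finite $S\subset \mathrm{Ext}(\mathcal C)$ such that $x$ is a convex combination of the points of $S$ with all weights positive) put $w(x,S)=\max_{y\in S,\,z\in\mathcal C}\nabla f(x)^T(y-z)$ and let $w(x)=\min_S w(x,S)$ over the proper supports of $x$. The away curvature is $$C_f^A=\sup_{x,s,v\in\mathcal C,\ \eta\in(0,1]}\tfrac{2}{\eta^2}\big(f(x+\eta(s-v))-f(x)-\eta\nabla f(x)^T(s-v)\big).$$ For $\delta>0$, $\mathcal C$ satisfies $\delta$-scaling if for every differentiable convex function $h:E\to\mathbb R$ (with $w$ and $X^*$ formed for $h$) and all $x\in\mathcal C\setminus X^*$, $x^*\in X^*$: $w(x)\ge\delta\,\nabla h(x)^T\frac{x-x^*}{\|x-x^*\|}$.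 For $\theta\in[0,1]$, $c>0$, $f$ satisfies $(\theta,c)$-HEB if $\min_{x^*\in X^*}\|x-x^*\|\le c\,(f(x)-f^*)^\theta$ for all $x\in\mathcal C$ (with $0^0=1$). *Fractional Away-Step Frank-Wolfe (FAFW)*, with parameter $\gamma>0$, starts from $x_0=\sum_{v\in\mathcal S_0}\alpha_0^v v$, where $\mathcal S_0\subset\mathrm{Ext}(\mathcal C)$ and the weights are positive with sum $1$. While $w(x_t,\mathcal S_t)>e^{-\gamma}w(x_0,\mathcal S_0)$ it takes a vertex $v_t\in\arg\min_{z\in\mathcal C}\nabla f(x_t)^Tz$ and $s_t\in\arg\max_{z\in\mathcal S_t}\nabla f(x_t)^Tz$; if $-\nabla f(x_t)^T(v_t-x_t)>e^{-\gamma}w(x_0,\mathcal S_0)/2$ it sets $d_t=v_t-x_t$, $\eta_{\max}=1$, otherwise $d_t=x_t-s_t$, $\eta_{\max}=\alpha_t^{s_t}/(1-\alpha_t^{s_t})$; it sets $x_{t+1}=x_t+\eta_td_t$ with $\eta_t$ an exact line-search minimizer on $[0,\eta_{\max}]$ and updates the weights accordingly ($\alpha\mapsto(1-\eta_t)\alpha+\eta_t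 e_{v_t}$, resp. $\alpha\mapsto(1+\eta_t)\alpha-\eta_te_{s_t}$), vertices of weight $0$ leaving the active set. The *restart scheme* with constant parameter $\gamma>0$ and accuracy $\epsilon>0$ calls FAFW repeatedly, each call starting at the output (point, active set, weights) of the previous one, as long as the current start of a call satisfies $w(x)>\epsilon$, and then outputs the current point. Iterations are counted cumulatively over all calls. **Statement.** Let $\gamma>0$. 1. There is $\delta>0$ such that $\mathcal C$ satisfies $\delta$-scaling. 2. For every $\epsilon>0$ the restart scheme terminates: there is an $N$ bounding the total number of iterations of all runs from all starting points, and from every starting point an output is reached. 3. Suppose $f$ satisfies $(\theta,c)$-HEB with $\theta\in[0,1]$, $c>0$, and $\mathcal C$ satisfies $\delta$-scaling with $\delta>0$; put $r=\frac1{1-\theta}$, $\mu=(c/\delta)^r$. Suppose that the starting point satisfies $e^{-\gamma}w_0/2\le C_f^A$, where $w_0=w(x_0,\mathcal S_0)$ (burn-in done). For every $\epsilon>0$, every output $x_T$ of the restart scheme, reached after $T$ iterations with active set $\mathcal S_T$, satisfies $$f(x_T)-f^*\le \frac{w_0}{\big(1+\tilde T\,C_\gamma^r\big)^{\frac1{2-r}}}\quad\text{if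 }1\le r<2,\qquad f(x_T)-f^*\le w_0\exp\Big(-\frac{\gamma}{e^{2\gamma}}\frac{\tilde T}{16\,C_f^A\mu}\Big)\quad\text{if }r=2,$$ where $\tilde T=\max\{0,\,T-(|\mathcal S_0|-|\mathcal S_T|)\}$ and $C_\gamma^r=\dfrac{e^{\gamma(2-r)}-1}{16\,e^{2\gamma}C_f^A\,\mu\,w_0^{r-2}}$ (if $w_0=0$ or $C_f^A=0$ then $w_0=0$ and both right-hand sides are read as $0$). 4. If $f$ is strongly convex on $\mathcal C$, then $f$ satisfies $(\frac12,c)$-HEB for some $c>0$ (so $r=2$), and the restart scheme converges linearly: there are $M$ and $\rho\in(0,1)$, depending only on $\mathcal C,f,\gamma$, such that for every accuracy $\epsilon>0$ and every starting point, without any burn-in assumption, every iterate $x_t$ (after $t$ iterations in total) satisfies $f(x_t)-f^*\le M\rho^t$. 5. Without further assumptions, $f$ satisfies $(0,c)$-HEB for some $c>0$ (so $r=1$), and the rate is $\mathcal O(1/t)$: there is $M$, depending only on $\mathcal C,f,\gamma$, such that for every accuracy $\epsilon>0$ and every starting point, without any burn-in assumption, every iterate $x_t$ with $t\ge1$ satisfies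 $f(x_t)-f^*\le M/t$. -/

import Mathlib

open Set Filter Topology
open scoped Pointwise NNReal

noncomputable section

namespace RestartFW

variable {E : Type*} [NormedAddCommGroup E] [NormedSpace ℝ E]

/-- A (nonempty) polytope: the convex hull of a nonempty finite set of points. -/
def IsPolytope (C : Set E) : Prop :=
  ∃ V : Finset E, V.Nonempty ∧ C = convexHull ℝ (V : Set E)

/-- A smooth convex function: `f` is convex and differentiable on the whole space and its gradient
is Lipschitz (from the given norm to the dual norm) on the Minkowski sum `C + (C - C)`, the set on
which the away curvature evaluates `f`. -/
structure IsSmoothConvex (C : Set E) (f : E → ℝ) : Prop where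
  convex : ConvexOn ℝ univ f
  differentiable : Differentiable ℝ f
  smooth : ∃ L : ℝ≥0, LipschitzOnWith L (fderiv ℝ f) (C + (C - C))

/-- The set `X*` of minimizers of `f` over `C`. -/
def minimizers (C : Set E) (f : E → ℝ) : Set E :=
  {x | x ∈ C ∧ IsMinOn f C x}

/-- The optimal value `f*` of `f` over `C`. -/
def optValue (C : Set E) (f : E → ℝ) : ℝ :=
  sInf (f '' C)

/-- `S` is a proper support of `x` in `C`: a finite set of extreme points of `C` such that `x` is a
convex combination of the elements of `S` with all weights positive. -/
def IsProperSupport (C : Set E) (x : E) (S : Finset E) : Prop :=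
  (S : Set E) ⊆ C.extremePoints ℝ ∧
    ∃ a : E → ℝ, (∀ v ∈ S, 0 < a v) ∧ ∑ v ∈ S, a v = 1 ∧ ∑ v ∈ S, a v • v = x

/-- `w(x, S) = max_{y ∈ S, z ∈ C} ⟨∇f(x), y - z⟩`. -/
def supportGap (C : Set E) (f : E → ℝ) (x : E) (S : Finset E) : ℝ :=
  sSup {a : ℝ | ∃ y ∈ S, ∃ z ∈ C, a = fderiv ℝ f x (y - z)}

/-- The strong Wolfe gap `w(x)`: the minimum of `w(x, S)` over the proper supports `S` of `x`. -/
def strongWolfeGap (C : Set E) (f : E → ℝ) (x : E) : ℝ :=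
  sInf {a : ℝ | ∃ S : Finset E, IsProperSupport C x S ∧ a = supportGap C f x S}

/-- The away curvature `C_f^A`. -/
def awayCurvature (C : Set E) (f : E → ℝ) : ℝ :=
  sSup {a : ℝ | ∃ x ∈ C, ∃ s ∈ C, ∃ v ∈ C, ∃ η ∈ Ioc (0 : ℝ) 1,
    a = 2 / η ^ 2 * (f (x + η • (s - v)) - f x - η * fderiv ℝ f x (s - v))}

/-- The `δ`-scaling inequality of `C`, for all differentiable convex functions. -/
def Scaling (C : Set E) (δ : ℝ) : Prop :=
  ∀ f : E → ℝ, ConvexOn ℝ univ f → Differentiable ℝ f →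
    ∀ x ∈ C \ minimizers C f, ∀ y ∈ minimizers C f,
      δ * fderiv ℝ f x (‖x - y‖⁻¹ • (x - y)) ≤ strongWolfeGap C f x

/-- The Hölderian error bound `(θ, c)`-HEB of `f` on `C`. -/
def HEB (C : Set E) (f : E → ℝ) (θ c : ℝ) : Prop :=
  ∀ x ∈ C, Metric.infDist x (minimizers C f) ≤ c * (f x - optValue C f) ^ θ

/-- The data carried by an iterate: a finitely supported weight function `α`, with support
`S ⊆ Ext(C)`, positive weights on `S`, and total weight one. -/
structure IsActiveRep (C : Set E) (α : E →₀ ℝ) : Prop where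
  extreme : ∀ v ∈ α.support, v ∈ C.extremePoints ℝ
  pos : ∀ v ∈ α.support, 0 < α v
  sum_eq_one : (α.sum fun _ a => a) = 1

/-- The iterate `x = ∑ α_v v` represented by the weights `α`. -/
def point (α : E →₀ ℝ) : E :=
  α.sum fun v a => a • v

/-- The observed gap `w(x, S)` of the iterate with weights `α` and active set `S = supp α`. -/
def gap (C : Set E) (f : E → ℝ) (α : E →₀ ℝ) : ℝ :=
  supportGap C f (point α) α.support

/-- `η` is an exact line-search step for `f` from `x` along `d` on `[0, ηmax]`. -/
def IsLineSearch (f : E → ℝ) (x d : E) (ηmax η : ℝ) : Prop :=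
  η ∈ Icc 0 ηmax ∧ IsMinOn (fun t : ℝ => f (x + t • d)) (Icc 0 ηmax) η

/-- One pass through the loop of the Fractional Away-Step Frank-Wolfe algorithm, where `W` is the
gap `w(x₀, S₀)` at the starting point of the call. The oracles and the line search may return any
optimal choice. Vertices whose weight becomes zero leave the active set. -/
def FracStep (C : Set E) (f : E → ℝ) (γ W : ℝ) (α α' : E →₀ ℝ) : Prop :=
  Real.exp (-γ) * W < gap C f α ∧
  ∃ v s : E, ∃ η : ℝ,
    (v ∈ C.extremePoints ℝ ∧ IsMinOn (fun z => fderiv ℝ f (point α) z) C v) ∧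
    (s ∈ α.support ∧ IsMaxOn (fun z => fderiv ℝ f (point α) z) (α.support : Set E) s) ∧
    ((Real.exp (-γ) * W / 2 < -(fderiv ℝ f (point α) (v - point α)) ∧
        IsLineSearch f (point α) (v - point α) 1 η ∧
        α' = (1 - η) • α + Finsupp.single v η) ∨
     (-(fderiv ℝ f (point α) (v - point α)) ≤ Real.exp (-γ) * W / 2 ∧
        IsLineSearch f (point α) (point α - s) (α s / (1 - α s)) η ∧
        α' = (1 + η) • α - Finsupp.single s η))

/-- `FracRun C f γ W α n β`: `n` passes of the loop, with reference gap `W`, lead from `α` to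
`β`. -/
inductive FracRun (C : Set E) (f : E → ℝ) (γ W : ℝ) (α : E →₀ ℝ) : ℕ → (E →₀ ℝ) → Prop
  | refl : FracRun C f γ W α 0 α
  | step {n : ℕ} {β β' : E →₀ ℝ} :
      FracRun C f γ W α n β → FracStep C f γ W β β' → FracRun C f γ W α (n + 1) β'

/-- The Fractional Away-Step Frank-Wolfe algorithm with parameter `γ`, started at `α`, stops after
`n` iterations with output `β`. -/
def FracOutput (C : Set E) (f : E → ℝ) (γ : ℝ) (α : E →₀ ℝ) (n : ℕ) (β : E →₀ ℝ) : Prop :=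
  FracRun C f γ (gap C f α) α n β ∧ gap C f β ≤ Real.exp (-γ) * gap C f α

/-- Restart scheme with constant parameter `γ` and accuracy `ε`: `RestartRun C f γ ε α₀ T α` says
that finitely many calls of the inner algorithm, `T` inner iterations in total, lead from `α₀` to
`α`; a new call is made only while `w(x) > ε`. -/
inductive RestartRun (C : Set E) (f : E → ℝ) (γ ε : ℝ) (α₀ : E →₀ ℝ) : ℕ → (E →₀ ℝ) → Prop
  | refl : RestartRun C f γ ε α₀ 0 α₀
  | restart {T n : ℕ} {α β : E →₀ ℝ} :
      RestartRun C f γ ε α₀ T α → ε < strongWolfeGap C f (point α) →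
      FracOutput C f γ α n β → RestartRun C f γ ε α₀ (T + n) β

/-- The restart scheme, started at `α₀`, stops with output `α` after `T` iterations in total. -/
def IsOutput (C : Set E) (f : E → ℝ) (γ ε : ℝ) (α₀ : E →₀ ℝ) (T : ℕ) (α : E →₀ ℝ) : Prop :=
  RestartRun C f γ ε α₀ T α ∧ strongWolfeGap C f (point α) ≤ ε

/-- `β` is an iterate of the restart scheme started at `α₀`, reached after `t` iterations in total;
this may be in the middle of a call of the inner algorithm. -/
def IsIterate (C : Set E) (f : E → ℝ) (γ ε : ℝ) (α₀ : E →₀ ℝ) (t : ℕ) (β : E →₀ ℝ) : Prop :=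
  RestartRun C f γ ε α₀ t β ∨
  ∃ (T n : ℕ) (α : E →₀ ℝ), RestartRun C f γ ε α₀ T α ∧ ε < strongWolfeGap C f (point α) ∧
    FracRun C f γ (gap C f α) α n β ∧ t = T + n

/-- `T̃ = T - (|S₀| - |S_T|)`, replaced by zero where it is negative. -/
def effectiveSteps (α₀ : E →₀ ℝ) (T : ℕ) (α : E →₀ ℝ) : ℝ :=
  max 0 ((T : ℝ) - ((α₀.support.card : ℝ) - (α.support.card : ℝ)))

/-- The constant `C_γ^r`, with `K = C_f^A`, `μ` the constant of the strong Wolfe primal bound and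
`w₀ = w(x₀, S₀)`. -/
def rateConst (γ r K μ w₀ : ℝ) : ℝ :=
  (Real.exp (γ * (2 - r)) - 1) / (16 * Real.exp (2 * γ) * K * μ * w₀ ^ (r - 2))

end RestartFW

end

open RestartFW

/-!
For a polytope, Carathéodory's theorem applied to the cone generated by the differences `y - z`,
with `y` in a proper support of `x` and `z` a vertex, writes `x - x*` as a combination of these
differences with total weight at most a constant times `‖x - x*‖`. This is the scaling inequality.
Together with convexity and the error bound it gives the strong Wolfe primal bound
`f x - f* ≤ μ w(x)^r`.

Within one call, started at gap `W`, every step either removes a vertex from the active set or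
decreases `f` by at least a multiple of `W² / K`, where `K` bounds the away curvature. As the primal
gap at the start of the call is at most `μ W^r`, the number of steps, less the number of dropped
vertices, is at most a multiple of `W^(r-2)`. A call shrinks the gap by the factor `exp (-γ)`, so
these bounds telescope along the potential `w^(r-2)` when `r < 2` and `-log w` when `r = 2`.
Enlarging `K` makes the burn-in condition true at every starting point.
-/

namespace RestartFW

section ConicCombination

variable {𝕜 ι F : Type*} [Field 𝕜] [LinearOrder 𝕜] [IsStrictOrderedRing 𝕜] [AddCommGroup F]
  [Module 𝕜 F] {g : ι → F} {t : Finset ι}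

theorem exists_pos_weight_of_not_linearIndepOn (h : ¬LinearIndepOn 𝕜 g (t : Set ι)) :
    ∃ k : ι → 𝕜, ∑ i ∈ t, k i • g i = 0 ∧ ∃ i ∈ t, 0 < k i := by
  rw [linearIndepOn_finset_iff] at h
  push Not at h
  obtain ⟨k, hk, i, hi, hki⟩ := h
  rcases lt_or_gt_of_ne hki with hneg | hpos
  · exact ⟨-k, by simp [hk], i, hi, neg_pos.2 hneg⟩
  · exact ⟨k, hk, i, hi, hpos⟩

theorem exists_conic_erase_of_not_linearIndepOn [DecidableEq ι] {a : ι → 𝕜}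
    (ha : ∀ i ∈ t, 0 ≤ a i) (h : ¬LinearIndepOn 𝕜 g (t : Set ι)) :
    ∃ i₀ ∈ t, ∃ b : ι → 𝕜, (∀ i ∈ t.erase i₀, 0 ≤ b i) ∧
      ∑ i ∈ t.erase i₀, b i • g i = ∑ i ∈ t, a i • g i := by
  obtain ⟨k, hk, i, hi, hki⟩ := exists_pos_weight_of_not_linearIndepOn h
  -- Subtract the largest multiple of the relation `k` that keeps all weights nonnegative.
  obtain ⟨i₀, hi₀, hmin⟩ := (t.filter (0 < k ·)).exists_min_image (fun i => a i / k i)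
    ⟨i, Finset.mem_filter.2 ⟨hi, hki⟩⟩
  obtain ⟨hi₀t, hki₀⟩ := Finset.mem_filter.1 hi₀
  refine ⟨i₀, hi₀t, fun i => a i - a i₀ / k i₀ * k i, fun i hi => sub_nonneg.2 ?_, ?_⟩
  · have hit := Finset.mem_of_mem_erase hi
    rcases lt_or_ge 0 (k i) with hpos | hneg
    · exact (le_div_iff₀ hpos).1 (hmin i (Finset.mem_filter.2 ⟨hit, hpos⟩))
    · exact (mul_nonpos_of_nonneg_of_nonpos (div_nonneg (ha i₀ hi₀t) hki₀.le) hneg).trans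
        (ha i hit)
  · have hi₀zero : (a i₀ - a i₀ / k i₀ * k i₀) • g i₀ = 0 := by
      rw [div_mul_cancel₀ _ hki₀.ne', sub_self, zero_smul]
    rw [Finset.sum_erase t hi₀zero]
    simp only [sub_smul, mul_smul, Finset.sum_sub_distrib, ← Finset.smul_sum, hk, smul_zero,
      sub_zero]

theorem exists_linearIndepOn_conic (g : ι → F) (t : Finset ι) {a : ι → 𝕜}
    (ha : ∀ i ∈ t, 0 ≤ a i) :
    ∃ t' ⊆ t, ∃ b : ι → 𝕜, (∀ i ∈ t', 0 ≤ b i) ∧ ∑ i ∈ t', b i • g i = ∑ i ∈ t, a i • g i ∧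
      LinearIndepOn 𝕜 g (t' : Set ι) := by
  classical
  induction t using Finset.strongInduction generalizing a with
  | H t ih =>
    by_cases hli : LinearIndepOn 𝕜 g (t : Set ι)
    · exact ⟨t, subset_rfl, a, ha, rfl, hli⟩
    · obtain ⟨i₀, hi₀, a', ha', hsum⟩ := exists_conic_erase_of_not_linearIndepOn ha hli
      obtain ⟨t', ht', b, hb, hbsum, hind⟩ := ih _ (Finset.erase_ssubset hi₀) ha'
      exact ⟨t', ht'.trans (Finset.erase_subset _ _), b, hb, hbsum.trans hsum, hind⟩

end ConicCombination

variable {E : Type*} [NormedAddCommGroup E] [NormedSpace ℝ E]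

theorem exists_sum_le_norm_of_linearIndepOn {ι : Type*} {g : ι → E} {t : Finset ι}
    (h : LinearIndepOn ℝ g (t : Set ι)) :
    ∃ κ : ℝ, 0 ≤ κ ∧ ∀ b : ι → ℝ, ∑ i ∈ t, b i ≤ κ * ‖∑ i ∈ t, b i • g i‖ := by
  have hli : LinearIndependent ℝ (fun i : t => g i) := h
  obtain ⟨K, -, hK⟩ := LinearMap.exists_antilipschitzWith
    (Fintype.linearCombination ℝ (fun i : t => g i))
    (LinearMap.ker_eq_bot.2 (linearIndependent_iff_injective_fintypeLinearCombination.1 hli))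
  refine ⟨t.card * K, by positivity, fun b => ?_⟩
  have hnorm : ‖fun i : t => b i‖ ≤ K * ‖∑ i ∈ t, b i • g i‖ := by
    rw [← Finset.sum_coe_sort t (fun i => b i • g i)]
    simpa [Fintype.linearCombination_apply, -Finset.univ_eq_attach]
      using hK.le_mul_norm_sub (fun i : t => b i) 0
  calc ∑ i ∈ t, b i ≤ ∑ _i ∈ t, K * ‖∑ i ∈ t, b i • g i‖ :=
        Finset.sum_le_sum fun i hi =>
          ((le_abs_self _).trans (norm_le_pi_norm (fun i : t => b i) ⟨i, hi⟩)).trans hnorm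
    _ = t.card * K * ‖∑ i ∈ t, b i • g i‖ := by rw [Finset.sum_const, nsmul_eq_mul, mul_assoc]

theorem exists_conic_weights_le {ι : Type*} (g : ι → E) (D : Finset ι) :
    ∃ κ : ℝ, 0 < κ ∧ ∀ t ⊆ D, ∀ a : ι → ℝ, (∀ i ∈ t, 0 ≤ a i) →
      ∃ t' ⊆ t, ∃ b : ι → ℝ, (∀ i ∈ t', 0 ≤ b i) ∧ ∑ i ∈ t', b i • g i = ∑ i ∈ t, a i • g i ∧
        ∑ i ∈ t', b i ≤ κ * ‖∑ i ∈ t, a i • g i‖ := by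
  have hindep : ∀ t : Finset ι, ∃ κ : ℝ, 0 ≤ κ ∧ (LinearIndepOn ℝ g (t : Set ι) →
      ∀ b : ι → ℝ, ∑ i ∈ t, b i ≤ κ * ‖∑ i ∈ t, b i • g i‖) := fun t => by
    by_cases ht : LinearIndepOn ℝ g (t : Set ι)
    · obtain ⟨κ, hκ, hle⟩ := exists_sum_le_norm_of_linearIndepOn ht
      exact ⟨κ, hκ, fun _ => hle⟩
    · exact ⟨0, le_rfl, fun h => absurd h ht⟩
  choose κ hκ hle using hindep
  have hsum : 0 ≤ ∑ t ∈ D.powerset, κ t := Finset.sum_nonneg fun t _ => hκ t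
  refine ⟨1 + ∑ t ∈ D.powerset, κ t, by linarith, fun t ht a ha => ?_⟩
  obtain ⟨t', ht', b, hb, hba, hli⟩ := exists_linearIndepOn_conic g t ha
  refine ⟨t', ht', b, hb, hba, hba ▸ (hle t' hli b).trans ?_⟩
  gcongr
  linarith [Finset.single_le_sum (fun t _ => hκ t) (Finset.mem_powerset.2 (ht'.trans ht))]

variable {C : Set E} {f : E → ℝ} {x : E} {S : Finset E}

section Polytope

theorem IsPolytope.convex (hC : IsPolytope C) : Convex ℝ C := by
  obtain ⟨V, -, rfl⟩ := hC
  exact convex_convexHull ℝ _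

theorem IsPolytope.isCompact (hC : IsPolytope C) : IsCompact C := by
  obtain ⟨V, -, rfl⟩ := hC
  exact V.finite_toSet.isCompact_convexHull ℝ

theorem IsPolytope.nonempty (hC : IsPolytope C) : C.Nonempty := by
  obtain ⟨V, hV, rfl⟩ := hC
  exact convexHull_nonempty_iff.2 hV

theorem IsPolytope.finite_extremePoints (hC : IsPolytope C) : (C.extremePoints ℝ).Finite := by
  obtain ⟨V, -, rfl⟩ := hC
  exact V.finite_toSet.subset extremePoints_convexHull_subset

theorem IsPolytope.convexHull_extremePoints (hC : IsPolytope C) :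
    convexHull ℝ (C.extremePoints ℝ) = C := by
  rw [← (hC.finite_extremePoints.isClosed_convexHull ℝ).closure_eq]
  exact closure_convexHull_extremePoints hC.isCompact hC.convex

theorem IsPolytope.exists_weights (hC : IsPolytope C) (hx : x ∈ C) :
    ∃ a : E → ℝ, (∀ v ∈ hC.finite_extremePoints.toFinset, 0 ≤ a v) ∧
      ∑ v ∈ hC.finite_extremePoints.toFinset, a v = 1 ∧
      ∑ v ∈ hC.finite_extremePoints.toFinset, a v • v = x := by
  rwa [← hC.convexHull_extremePoints, ← hC.finite_extremePoints.coe_toFinset,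
    Finset.mem_convexHull'] at hx

theorem IsPolytope.exists_isProperSupport (hC : IsPolytope C) (hx : x ∈ C) :
    ∃ S, IsProperSupport C x S := by
  classical
  obtain ⟨a, ha, hsum, hax⟩ := hC.exists_weights hx
  refine ⟨hC.finite_extremePoints.toFinset.filter (a · ≠ 0), fun v hv => ?_, a, fun v hv => ?_,
    (Finset.sum_filter_ne_zero _).trans hsum, hax ▸ Finset.sum_filter_of_ne fun v _ h h0 => ?_⟩
  · exact hC.finite_extremePoints.mem_toFinset.1 (Finset.mem_filter.1 hv).1
  · exact (ha v (Finset.mem_filter.1 hv).1).lt_of_ne' (Finset.mem_filter.1 hv).2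
  · exact h (by rw [h0, zero_smul])

theorem IsPolytope.exists_extremePoint_isMinOn (hC : IsPolytope C) (ℓ : E →ₗ[ℝ] ℝ) :
    ∃ v ∈ C.extremePoints ℝ, IsMinOn (fun z => ℓ z) C v := by
  obtain ⟨v, hv, hmin⟩ := hC.finite_extremePoints.exists_minimalFor (fun z => ℓ z) _
    (hC.isCompact.extremePoints_nonempty hC.nonempty)
  have hvertices : C.extremePoints ℝ ⊆ {z | ℓ v ≤ ℓ z} := fun u hu =>
    (le_total (ℓ v) (ℓ u)).elim id (hmin hu)
  refine ⟨v, hv, fun z hz => ?_⟩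
  rw [← hC.convexHull_extremePoints] at hz
  exact convexHull_min hvertices (convex_halfSpace_ge ℓ.isLinear _) hz

end Polytope

section Gap

theorem IsProperSupport.subset (hS : IsProperSupport C x S) : (S : Set E) ⊆ C :=
  hS.1.trans extremePoints_subset

theorem IsProperSupport.nonempty (hS : IsProperSupport C x S) : S.Nonempty := by
  obtain ⟨-, a, -, hsum, -⟩ := hS
  exact Finset.nonempty_of_sum_ne_zero (hsum ▸ one_ne_zero)

theorem bddAbove_supportGap (hC : IsCompact C) (f : E → ℝ) (x : E) (S : Finset E) :
    BddAbove {a : ℝ | ∃ y ∈ S, ∃ z ∈ C, a = fderiv ℝ f x (y - z)} := by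
  have hcompact : IsCompact ((fun p : E × E => fderiv ℝ f x (p.1 - p.2)) '' ((S : Set E) ×ˢ C)) :=
    (S.finite_toSet.isCompact.prod hC).image (by fun_prop)
  refine hcompact.bddAbove.mono ?_
  rintro a ⟨y, hy, z, hz, rfl⟩
  exact ⟨(y, z), ⟨hy, hz⟩, rfl⟩

theorem le_supportGap (hC : IsCompact C) {y z : E} (hy : y ∈ S) (hz : z ∈ C) :
    fderiv ℝ f x (y - z) ≤ supportGap C f x S :=
  le_csSup (bddAbove_supportGap hC f x S) ⟨y, hy, z, hz, rfl⟩

theorem supportGap_eq {s v : E} (hs : s ∈ S)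
    (hmax : IsMaxOn (fun z => fderiv ℝ f x z) (S : Set E) s) (hv : v ∈ C)
    (hmin : IsMinOn (fun z => fderiv ℝ f x z) C v) :
    supportGap C f x S = fderiv ℝ f x (s - v) := by
  refine IsGreatest.csSup_eq ⟨⟨s, hs, v, hv, rfl⟩, ?_⟩
  rintro a ⟨y, hy, z, hz, rfl⟩
  rw [map_sub, map_sub]
  exact sub_le_sub (hmax hy) (hmin hz)

theorem IsProperSupport.supportGap_nonneg (hC : IsCompact C) (hS : IsProperSupport C x S) :
    0 ≤ supportGap C f x S := by
  obtain ⟨y, hy⟩ := hS.nonempty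
  simpa using le_supportGap (f := f) (x := x) hC hy (hS.subset hy)

theorem IsProperSupport.fderiv_sub_le (hC : IsCompact C) (hS : IsProperSupport C x S) {z : E}
    (hz : z ∈ C) : fderiv ℝ f x (x - z) ≤ supportGap C f x S := by
  obtain ⟨-, a, hpos, hsum, hx⟩ := hS
  have hxz : x - z = ∑ v ∈ S, a v • (v - z) := by
    simp only [smul_sub, Finset.sum_sub_distrib, ← Finset.sum_smul, hsum, hx, one_smul]
  calc fderiv ℝ f x (x - z) = ∑ v ∈ S, a v * fderiv ℝ f x (v - z) := by
        simp only [congrArg (fderiv ℝ f x) hxz, map_sum, map_smul, smul_eq_mul]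
    _ ≤ ∑ v ∈ S, a v * supportGap C f x S := Finset.sum_le_sum fun v hv =>
        mul_le_mul_of_nonneg_left (le_supportGap hC hv hz) (hpos v hv).le
    _ = supportGap C f x S := by rw [← Finset.sum_mul, hsum, one_mul]

theorem strongWolfeGap_le (hC : IsCompact C) (hS : IsProperSupport C x S) :
    strongWolfeGap C f x ≤ supportGap C f x S :=
  csInf_le ⟨0, by rintro a ⟨S', hS', rfl⟩; exact hS'.supportGap_nonneg hC⟩ ⟨S, hS, rfl⟩

theorem le_strongWolfeGap (hC : IsPolytope C) (hx : x ∈ C) {b : ℝ}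
    (h : ∀ S, IsProperSupport C x S → b ≤ supportGap C f x S) : b ≤ strongWolfeGap C f x := by
  obtain ⟨S, hS⟩ := hC.exists_isProperSupport hx
  refine le_csInf ⟨_, S, hS, rfl⟩ ?_
  rintro a ⟨S', hS', rfl⟩
  exact h S' hS'

theorem strongWolfeGap_nonneg (hC : IsPolytope C) (hx : x ∈ C) : 0 ≤ strongWolfeGap C f x :=
  le_strongWolfeGap hC hx fun _ hS => hS.supportGap_nonneg hC.isCompact

end Gap

section Scaling

theorem sum_product_smul_sub {R M : Type*} [Ring R] [AddCommGroup M] [Module R M]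
    {S V : Finset M} {a b : M → R} (ha : ∑ u ∈ S, a u = 1) (hb : ∑ v ∈ V, b v = 1) :
    ∑ p ∈ S ×ˢ V, (a p.1 * b p.2) • (p.1 - p.2) = ∑ u ∈ S, a u • u - ∑ v ∈ V, b v • v := by
  have hrow : ∀ u ∈ S, ∑ v ∈ V, (a u * b v) • (u - v) = a u • (u - ∑ v ∈ V, b v • v) :=
    fun u _ => by
      simp only [mul_smul, smul_sub, Finset.sum_sub_distrib, ← Finset.smul_sum, ← Finset.sum_smul,
        hb, one_smul]
  rw [Finset.sum_product, Finset.sum_congr rfl hrow]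
  simp only [smul_sub, Finset.sum_sub_distrib, ← Finset.sum_smul, ha, one_smul]

theorem IsPolytope.exists_apply_sub_le (hC : IsPolytope C) :
    ∃ κ : ℝ, 0 < κ ∧ ∀ (ℓ : E →ₗ[ℝ] ℝ) (M : ℝ), 0 ≤ M → ∀ (x : E) (S : Finset E),
      IsProperSupport C x S → (∀ u ∈ S, ∀ z ∈ C, ℓ (u - z) ≤ M) →
      ∀ y ∈ C, ℓ (x - y) ≤ κ * ‖x - y‖ * M := by
  classical
  set V := hC.finite_extremePoints.toFinset
  obtain ⟨κ, hκ, hweights⟩ := exists_conic_weights_le (fun p : E × E => p.1 - p.2) (V ×ˢ V)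
  refine ⟨κ, hκ, fun ℓ M hM x S hS hℓ y hy => ?_⟩
  obtain ⟨hSext, a, ha, hasum, rfl⟩ := hS
  obtain ⟨b, hb, hbsum, rfl⟩ := hC.exists_weights hy
  have hSV : S ⊆ V := fun u hu => hC.finite_extremePoints.mem_toFinset.2 (hSext hu)
  obtain ⟨t, ht, c, hc, hcsum, hcle⟩ := hweights (S ×ˢ V) (Finset.product_subset_product_left hSV)
    (fun p => a p.1 * b p.2) fun p hp =>
      mul_nonneg (ha _ (Finset.mem_product.1 hp).1).le (hb _ (Finset.mem_product.1 hp).2)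
  rw [sum_product_smul_sub hasum hbsum] at hcsum hcle
  have hpair : ∀ p ∈ t, ℓ (p.1 - p.2) ≤ M := fun p hp => by
    obtain ⟨hp₁, hp₂⟩ := Finset.mem_product.1 (ht hp)
    exact hℓ _ hp₁ _ (extremePoints_subset (hC.finite_extremePoints.mem_toFinset.1 hp₂))
  calc ℓ (∑ u ∈ S, a u • u - ∑ v ∈ V, b v • v) = ∑ p ∈ t, c p * ℓ (p.1 - p.2) := by
        rw [← hcsum]
        simp only [map_sum, map_smul, smul_eq_mul]
    _ ≤ ∑ p ∈ t, c p * M :=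
        Finset.sum_le_sum fun p hp => mul_le_mul_of_nonneg_left (hpair p hp) (hc p hp)
    _ = (∑ p ∈ t, c p) * M := by rw [Finset.sum_mul]
    _ ≤ κ * ‖∑ u ∈ S, a u • u - ∑ v ∈ V, b v • v‖ * M := mul_le_mul_of_nonneg_right hcle hM

theorem IsPolytope.exists_scaling (hC : IsPolytope C) : ∃ δ : ℝ, 0 < δ ∧ Scaling C δ := by
  obtain ⟨κ, hκ, hle⟩ := hC.exists_apply_sub_le
  refine ⟨κ⁻¹, inv_pos.2 hκ, fun f _ _ x hx y hy => le_strongWolfeGap hC hx.1 fun S hS => ?_⟩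
  have hxy : 0 < ‖x - y‖ := norm_sub_pos_iff.2 fun h => hx.2 (h ▸ hy)
  have hbound : fderiv ℝ f x (x - y) ≤ κ * ‖x - y‖ * supportGap C f x S :=
    hle (fderiv ℝ f x) _ (hS.supportGap_nonneg hC.isCompact) x S hS
      (fun u hu z hz => le_supportGap hC.isCompact hu hz) y hy.1
  rw [map_smul, smul_eq_mul]
  calc κ⁻¹ * (‖x - y‖⁻¹ * fderiv ℝ f x (x - y))
      ≤ κ⁻¹ * (‖x - y‖⁻¹ * (κ * ‖x - y‖ * supportGap C f x S)) := by gcongr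
    _ = supportGap C f x S := by field_simp

end Scaling

section Minimizers

variable {X : Type*} {D : Set X} {φ : X → ℝ}

theorem optValue_eq {y : X} (hy : y ∈ minimizers D φ) : optValue D φ = φ y :=
  IsLeast.csInf_eq ⟨⟨y, hy.1, rfl⟩, by rintro _ ⟨z, hz, rfl⟩; exact hy.2 hz⟩

theorem minimizers_eq_inter {y : X} (hy : y ∈ minimizers D φ) :
    minimizers D φ = D ∩ φ ⁻¹' Iic (φ y) :=
  Subset.antisymm (fun _ hx => ⟨hx.1, hx.2 hy.1⟩)
    fun _ hx => ⟨hx.1, isMinOn_iff.2 fun _ hz => le_trans (mem_Iic.1 hx.2) (hy.2 hz)⟩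

variable [TopologicalSpace X]

theorem minimizers_nonempty (hD : IsCompact D) (hne : D.Nonempty) (hφ : ContinuousOn φ D) :
    (minimizers D φ).Nonempty :=
  hD.exists_isMinOn hne hφ

theorem optValue_le (hD : IsCompact D) (hφ : ContinuousOn φ D) {x : X} (hx : x ∈ D) :
    optValue D φ ≤ φ x := by
  obtain ⟨y, hy⟩ := minimizers_nonempty hD ⟨x, hx⟩ hφ
  exact (optValue_eq hy).trans_le (hy.2 hx)

theorem isCompact_minimizers [T2Space X] (hD : IsCompact D) (hφ : ContinuousOn φ D) :
    IsCompact (minimizers D φ) := by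
  rcases (minimizers D φ).eq_empty_or_nonempty with hempty | ⟨y, hy⟩
  · exact hempty ▸ isCompact_empty
  · rw [minimizers_eq_inter hy]
    exact hD.of_isClosed_subset (hφ.preimage_isClosed_of_isClosed hD.isClosed isClosed_Iic)
      inter_subset_left

end Minimizers

section Convexity

theorem sub_le_fderiv_of_convexOn {D : Set E} (hf : ConvexOn ℝ D f) {f' : E →L[ℝ] ℝ} {x y : E}
    (hx : x ∈ D) (hy : y ∈ D) (hf' : HasFDerivAt f f' x) : f x - f y ≤ f' (x - y) := by
  have hderiv : HasDerivAt (f ∘ AffineMap.lineMap (k := ℝ) x y) (f' (y - x)) 0 :=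
    HasFDerivAt.comp_hasDerivAt (0 : ℝ) (by simpa using hf') AffineMap.hasDerivAt_lineMap
  have hslope := (hf.comp_affineMap (AffineMap.lineMap x y)).le_slope_of_hasDerivAt
    (show (0 : ℝ) ∈ _ by simpa) (show (1 : ℝ) ∈ _ by simpa) one_pos hderiv
  simp only [slope_def_field, Function.comp_apply, AffineMap.lineMap_apply_zero,
    AffineMap.lineMap_apply_one, sub_zero, div_one] at hslope
  rw [← neg_sub y x, map_neg]
  linarith

theorem isMinOn_Ici_of_isMinOn_Icc {φ : ℝ → ℝ} {a b η : ℝ} (hφ : ConvexOn ℝ (Ici a) φ)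
    (hη : η ∈ Ico a b) (hmin : IsMinOn φ (Icc a b) η) : IsMinOn φ (Ici a) η := by
  refine IsMinOn.of_isLocalMinOn_of_convexOn hη.1 ?_ hφ
  filter_upwards [self_mem_nhdsWithin, mem_nhdsWithin_of_mem_nhds (Iio_mem_nhds hη.2)]
    with t ha hb using hmin ⟨ha, hb.le⟩

theorem convexOn_comp_line (hf : ConvexOn ℝ univ f) (x d : E) (D : Set ℝ) (hD : Convex ℝ D) :
    ConvexOn ℝ D (fun t : ℝ => f (x + t • d)) := by
  have hline := hf.comp_affineMap (AffineMap.lineMap (k := ℝ) x (x + d))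
  simp only [Function.comp_def, AffineMap.lineMap_apply, vsub_eq_sub, vadd_eq_add,
    add_sub_cancel_left, add_comm _ x, preimage_univ] at hline
  exact hline.subset (subset_univ _) hD

theorem IsLineSearch.isMinOn_Icc_zero_one (hf : ConvexOn ℝ univ f) {x d : E} {ηmax η : ℝ}
    (h : IsLineSearch f x d ηmax η) (hη : 1 ≤ ηmax ∨ η < ηmax) :
    IsMinOn (fun t : ℝ => f (x + t • d)) (Icc 0 1) η := by
  rcases hη with hone | hlt
  · exact h.2.on_subset (Icc_subset_Icc_right hone)
  · exact (isMinOn_Ici_of_isMinOn_Icc (convexOn_comp_line hf x d _ (convex_Ici 0))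
      ⟨h.1.1, hlt⟩ h.2).on_subset Icc_subset_Ici_self

theorem IsLineSearch.apply_le {x d : E} {ηmax η : ℝ} (h : IsLineSearch f x d ηmax η) :
    f (x + η • d) ≤ f x := by
  simpa using h.2 (left_mem_Icc.2 (h.1.1.trans h.1.2))

end Convexity

section Curvature

theorem norm_sub_sub_fderiv_le {F : Type*} [NormedAddCommGroup F] [NormedSpace ℝ F] {φ : E → F}
    {D : Set E} (hD : Convex ℝ D) (hφ : ∀ z ∈ D, DifferentiableAt ℝ φ z) {L : ℝ≥0}
    (hL : LipschitzOnWith L (fderiv ℝ φ) D) {x y : E} (hx : x ∈ D) (hy : y ∈ D) :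
    ‖φ y - φ x - fderiv ℝ φ x (y - x)‖ ≤ L * ‖y - x‖ ^ 2 := by
  have hseg : segment ℝ x y ⊆ D := hD.segment_subset hx hy
  rw [sq, ← mul_assoc]
  exact (convex_segment x y).norm_image_sub_le_of_norm_hasFDerivWithin_le'
    (fun z hz => (hφ z (hseg hz)).hasFDerivAt.hasFDerivWithinAt)
    (fun z hz => (hL.norm_sub_le (hseg hz) hx).trans <|
      mul_le_mul_of_nonneg_left (norm_sub_le_of_mem_segment hz) L.2)
    (left_mem_segment ℝ x y) (right_mem_segment ℝ x y)

theorem subset_add_sub_self {G : Type*} [AddGroup G] (D : Set G) : D ⊆ D + (D - D) :=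
  fun x hx => ⟨x, hx, 0, ⟨x, hx, x, hx, sub_self x⟩, add_zero x⟩

theorem add_smul_sub_mem_add_sub (hC : Convex ℝ C) {x s v : E} (hx : x ∈ C) (hs : s ∈ C)
    (hv : v ∈ C) {η : ℝ} (hη : η ∈ Icc (0 : ℝ) 1) : x + η • (s - v) ∈ C + (C - C) := by
  refine ⟨x, hx, η • (s - v), ⟨η • s + (1 - η) • v,
    hC hs hv hη.1 (sub_nonneg.2 hη.2) (add_sub_cancel η 1), v, hv, ?_⟩, rfl⟩
  module

theorem bddAbove_awayCurvature (hC : Convex ℝ C) (hbdd : Bornology.IsBounded C)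
    (hf : IsSmoothConvex C f) :
    BddAbove {a : ℝ | ∃ x ∈ C, ∃ s ∈ C, ∃ v ∈ C, ∃ η ∈ Ioc (0 : ℝ) 1,
      a = 2 / η ^ 2 * (f (x + η • (s - v)) - f x - η * fderiv ℝ f x (s - v))} := by
  obtain ⟨L, hL⟩ := hf.smooth
  refine ⟨2 * (L * Metric.diam C ^ 2), ?_⟩
  rintro a ⟨x, hx, s, hs, v, hv, η, hη, rfl⟩
  have hdescent : f (x + η • (s - v)) - f x - η * fderiv ℝ f x (s - v) ≤
      L * (η * ‖s - v‖) ^ 2 := by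
    have hnorm := (le_abs_self _).trans <| norm_sub_sub_fderiv_le (hC.add (hC.sub hC))
      (fun z _ => hf.differentiable z) hL (subset_add_sub_self C hx)
      (add_smul_sub_mem_add_sub hC hx hs hv (Ioc_subset_Icc_self hη))
    rwa [add_sub_cancel_left, map_smul, smul_eq_mul, norm_smul, Real.norm_of_nonneg hη.1.le]
      at hnorm
  have hdiam : ‖s - v‖ ≤ Metric.diam C :=
    (dist_eq_norm s v).symm.trans_le (Metric.dist_le_diam_of_mem hbdd hs hv)
  calc 2 / η ^ 2 * (f (x + η • (s - v)) - f x - η * fderiv ℝ f x (s - v))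
      ≤ 2 / η ^ 2 * (L * (η * ‖s - v‖) ^ 2) := by gcongr
    _ = 2 * (L * ‖s - v‖ ^ 2) := by
        have := hη.1.ne'
        field_simp
    _ ≤ 2 * (L * Metric.diam C ^ 2) := by gcongr

/-- `K` bounds the away curvature of `f` on `C`, written without division by the step size. The
rates hold for every such `K`, and enlarging `K` absorbs the burn-in phase. -/
def AwayCurvatureLE (C : Set E) (f : E → ℝ) (K : ℝ) : Prop :=
  ∀ x ∈ C, ∀ s ∈ C, ∀ v ∈ C, ∀ η ∈ Icc (0 : ℝ) 1,
    f (x + η • (s - v)) ≤ f x + η * fderiv ℝ f x (s - v) + η ^ 2 * K / 2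

theorem AwayCurvatureLE.mono {K K' : ℝ} (h : AwayCurvatureLE C f K) (hK : K ≤ K') :
    AwayCurvatureLE C f K' := fun x hx s hs v hv η hη =>
  (h x hx s hs v hv η hη).trans (by gcongr)

theorem awayCurvatureLE_awayCurvature (hC : Convex ℝ C) (hbdd : Bornology.IsBounded C)
    (hf : IsSmoothConvex C f) : AwayCurvatureLE C f (awayCurvature C f) := by
  intro x hx s hs v hv η hη
  rcases hη.1.eq_or_lt with rfl | hpos
  · simp
  have hle : 2 / η ^ 2 * (f (x + η • (s - v)) - f x - η * fderiv ℝ f x (s - v)) ≤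
      awayCurvature C f :=
    le_csSup (bddAbove_awayCurvature hC hbdd hf) ⟨x, hx, s, hs, v, hv, η, ⟨hpos, hη.2⟩, rfl⟩
  rw [div_mul_eq_mul_div, div_le_iff₀ (by positivity)] at hle
  linarith

theorem awayCurvature_nonneg (hC : Convex ℝ C) (hbdd : Bornology.IsBounded C) (hne : C.Nonempty)
    (hf : IsSmoothConvex C f) : 0 ≤ awayCurvature C f := by
  obtain ⟨x, hx⟩ := hne
  exact le_csSup (bddAbove_awayCurvature hC hbdd hf)
    ⟨x, hx, x, hx, x, hx, 1, ⟨one_pos, le_rfl⟩, by simp⟩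

theorem AwayCurvatureLE.sq_le_of_isMinOn {K Γ η : ℝ} {x s v : E} (h : AwayCurvatureLE C f K)
    (hx : x ∈ C) (hs : s ∈ C) (hv : v ∈ C) (hΓ : 0 ≤ Γ) (hΓK : Γ ≤ K)
    (hslope : fderiv ℝ f x (s - v) ≤ -Γ)
    (hmin : IsMinOn (fun t : ℝ => f (x + t • (s - v))) (Icc 0 1) η) :
    Γ ^ 2 ≤ 2 * K * (f x - f (x + η • (s - v))) := by
  rcases (hΓ.trans hΓK).eq_or_lt with rfl | hK
  · simp [le_antisymm hΓK hΓ]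
  -- The step `Γ / K` minimizes the quadratic upper model `t ↦ -t Γ + t ^ 2 K / 2`.
  have hstep : Γ / K ∈ Icc (0 : ℝ) 1 := ⟨by positivity, (div_le_one hK).2 hΓK⟩
  have hmodel := (hmin hstep).trans (h x hx s hs v hv _ hstep)
  have hlinear := mul_le_mul_of_nonneg_left hslope hstep.1
  have hvalue : 2 * K * (Γ / K * -Γ + (Γ / K) ^ 2 * K / 2) = -Γ ^ 2 := by
    field_simp
    ring
  nlinarith

theorem exists_fderiv_sub_le (hC : IsCompact C) (hf : ContinuousOn (fderiv ℝ f) C) :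
    ∃ B : ℝ, ∀ x ∈ C, ∀ y ∈ C, ∀ z ∈ C, fderiv ℝ f x (y - z) ≤ B := by
  have hcont : ContinuousOn (fun p : E × E × E => fderiv ℝ f p.1 (p.2.1 - p.2.2))
      (C ×ˢ C ×ˢ C) :=
    (hf.comp continuousOn_fst fun p hp => hp.1).clm_apply (by fun_prop)
  obtain ⟨B, hB⟩ := (hC.prod (hC.prod hC)).exists_bound_of_continuousOn hcont
  exact ⟨B, fun x hx y hy z hz => (le_abs_self _).trans (hB (x, y, z) ⟨hx, hy, hz⟩)⟩

end Curvature

theorem IsProperSupport.sub_optValue_le (hC : IsCompact C) (hcx : ConvexOn ℝ C f)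
    (hd : Differentiable ℝ f) (hx : x ∈ C) (hS : IsProperSupport C x S) :
    f x - optValue C f ≤ supportGap C f x S := by
  obtain ⟨y, hy⟩ := minimizers_nonempty hC ⟨x, hx⟩ hd.continuous.continuousOn
  rw [optValue_eq hy]
  exact (sub_le_fderiv_of_convexOn hcx hx hy.1 (hd x).hasFDerivAt).trans (hS.fderiv_sub_le hC hy.1)

section Weights

variable {V : Type*} {w : V →₀ ℝ} {v : V} {η : ℝ}

/-- The weights of an iterate after a step of length `η` towards `v`. An away step of length `η`
from `s` is the step of length `-η` towards `s`. -/
noncomputable def moveToward (w : V →₀ ℝ) (v : V) (η : ℝ) : V →₀ ℝ :=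
  (1 - η) • w + Finsupp.single v η

theorem one_add_smul_sub_single (w : V →₀ ℝ) (s : V) (η : ℝ) :
    (1 + η) • w - Finsupp.single s η = moveToward w s (-η) := by
  rw [moveToward, sub_neg_eq_add, Finsupp.single_neg, sub_eq_add_neg]

theorem moveToward_apply_self (w : V →₀ ℝ) (v : V) (η : ℝ) :
    moveToward w v η v = (1 - η) * w v + η := by
  simp [moveToward]

theorem moveToward_apply_of_ne {u : V} (huv : u ≠ v) : moveToward w v η u = (1 - η) * w u := by
  simp [moveToward, huv]

theorem sum_moveToward (hw : (w.sum fun _ a => a) = 1) :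
    ((moveToward w v η).sum fun _ a => a) = 1 := by
  have hsum : ∀ w : V →₀ ℝ, (w.sum fun _ a => a) =
      Finsupp.linearCombination ℝ (fun _ => (1 : ℝ)) w := by
    simp [Finsupp.linearCombination_apply]
  rw [hsum] at hw ⊢
  simp [moveToward, hw]

theorem support_moveToward_subset [DecidableEq V] (w : V →₀ ℝ) (v : V) (η : ℝ) :
    (moveToward w v η).support ⊆ insert v w.support := fun u hu => by
  by_contra h
  rw [Finset.mem_insert, not_or, Finsupp.notMem_support_iff] at h
  exact Finsupp.mem_support_iff.1 hu (by rw [moveToward_apply_of_ne h.1, h.2, mul_zero])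

theorem card_support_moveToward_le (w : V →₀ ℝ) (v : V) (η : ℝ) :
    (moveToward w v η).support.card ≤ w.support.card + 1 := by
  classical
  exact (Finset.card_le_card (support_moveToward_subset w v η)).trans (Finset.card_insert_le _ _)

theorem support_moveToward_subset_of_mem (hv : v ∈ w.support) (η : ℝ) :
    (moveToward w v η).support ⊆ w.support := by
  classical
  exact (support_moveToward_subset w v η).trans (Finset.insert_eq_of_mem hv).subset

theorem card_support_moveToward_lt (hv : v ∈ w.support) (hzero : moveToward w v η v = 0) :
    (moveToward w v η).support.card < w.support.card :=
  Finset.card_lt_card ⟨support_moveToward_subset_of_mem hv η,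
    fun h => Finsupp.mem_support_iff.1 (h hv) hzero⟩

theorem point_moveToward (α : E →₀ ℝ) (v : E) (η : ℝ) :
    point (moveToward α v η) = point α + η • (v - point α) := by
  have hpoint : ∀ α : E →₀ ℝ, point α = Finsupp.linearCombination ℝ id α := fun _ => rfl
  simp only [hpoint, moveToward, map_add, map_smul, Finsupp.linearCombination_single, id]
  module

theorem point_moveToward_neg (α : E →₀ ℝ) (s : E) (η : ℝ) :
    point (moveToward α s (-η)) = point α + η • (point α - s) := by
  rw [point_moveToward, neg_smul, ← smul_neg, neg_sub]

end Weights

section ActiveRep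

variable {α : E →₀ ℝ} {s v : E} {η : ℝ}

theorem IsActiveRep.isProperSupport (h : IsActiveRep C α) :
    IsProperSupport C (point α) α.support :=
  ⟨fun v hv => h.extreme v hv, α, h.pos, h.sum_eq_one, rfl⟩

theorem IsActiveRep.nonneg (h : IsActiveRep C α) (v : E) : 0 ≤ α v := by
  by_cases hv : v ∈ α.support
  · exact (h.pos v hv).le
  · exact (Finsupp.notMem_support_iff.1 hv).ge

theorem IsActiveRep.point_mem (hC : Convex ℝ C) (h : IsActiveRep C α) : point α ∈ C :=
  hC.sum_mem (fun v hv => (h.pos v hv).le) h.sum_eq_one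
    fun v hv => extremePoints_subset (h.extreme v hv)

theorem IsActiveRep.le_one (h : IsActiveRep C α) (hs : s ∈ α.support) : α s ≤ 1 :=
  (Finset.single_le_sum (fun v _ => h.nonneg v) hs).trans_eq h.sum_eq_one

theorem IsActiveRep.eq_single_of_apply_eq_one (h : IsActiveRep C α) (hs : s ∈ α.support)
    (hone : α s = 1) : α = Finsupp.single s 1 := by
  classical
  have hrest : ∑ v ∈ α.support.erase s, α v = 0 := by
    have hsum : ∑ v ∈ α.support, α v = 1 := h.sum_eq_one
    rw [← Finset.add_sum_erase _ _ hs] at hsum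
    linarith
  ext v
  rcases eq_or_ne v s with rfl | hvs
  · rw [hone, Finsupp.single_eq_same]
  rw [Finsupp.single_eq_of_ne hvs]
  by_contra hv
  exact hv ((Finset.sum_eq_zero_iff_of_nonneg fun v _ => h.nonneg v).1 hrest v
    (Finset.mem_erase.2 ⟨hvs, Finsupp.mem_support_iff.2 hv⟩))

theorem IsActiveRep.point_eq_of_apply_eq_one (h : IsActiveRep C α) (hs : s ∈ α.support)
    (hone : α s = 1) : point α = s := by
  rw [h.eq_single_of_apply_eq_one hs hone]
  simp [point]

theorem IsActiveRep.card_le (hfin : (C.extremePoints ℝ).Finite) (h : IsActiveRep C α) :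
    α.support.card ≤ (C.extremePoints ℝ).ncard :=
  (Set.ncard_coe_finset α.support).symm.trans_le (Set.ncard_le_ncard h.extreme hfin)

theorem IsActiveRep.moveToward (h : IsActiveRep C α) (hv : v ∈ C.extremePoints ℝ) (hη : η ≤ 1)
    (hself : 0 ≤ (1 - η) * α v + η) : IsActiveRep C (moveToward α v η) := by
  classical
  have hnonneg : ∀ u, 0 ≤ RestartFW.moveToward α v η u := fun u => by
    rcases eq_or_ne u v with rfl | huv
    · rwa [moveToward_apply_self]
    · rw [moveToward_apply_of_ne huv]
      exact mul_nonneg (sub_nonneg.2 hη) (h.nonneg u)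
  refine ⟨fun u hu => ?_, fun u hu => (hnonneg u).lt_of_ne' (Finsupp.mem_support_iff.1 hu),
    sum_moveToward h.sum_eq_one⟩
  rcases Finset.mem_insert.1 (support_moveToward_subset α v η hu) with rfl | hu
  · exact hv
  · exact h.extreme u hu

theorem IsActiveRep.moveToward_frankWolfe (h : IsActiveRep C α) (hv : v ∈ C.extremePoints ℝ)
    (hη : η ∈ Icc (0 : ℝ) 1) : IsActiveRep C (RestartFW.moveToward α v η) :=
  h.moveToward hv hη.2 (add_nonneg (mul_nonneg (sub_nonneg.2 hη.2) (h.nonneg v)) hη.1)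

theorem IsActiveRep.moveToward_away (h : IsActiveRep C α) (hs : s ∈ α.support)
    (hη : η ∈ Icc (0 : ℝ) (α s / (1 - α s))) : IsActiveRep C (RestartFW.moveToward α s (-η)) := by
  refine h.moveToward (h.extreme s hs) (by linarith [hη.1]) ?_
  rcases (h.le_one hs).eq_or_lt with hone | hlt
  · -- A single active vertex has step bound `1 / 0 = 0`.
    have hbound := hη.2
    rw [hone, sub_self, div_zero] at hbound
    rw [hone]
    linarith
  · linarith [(le_div_iff₀ (sub_pos.2 hlt)).1 hη.2]

theorem IsActiveRep.gap_nonneg (hC : IsCompact C) (h : IsActiveRep C α) : 0 ≤ gap C f α :=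
  h.isProperSupport.supportGap_nonneg hC

theorem IsActiveRep.strongWolfeGap_le_gap (hC : IsCompact C) (h : IsActiveRep C α) :
    strongWolfeGap C f (point α) ≤ gap C f α :=
  strongWolfeGap_le hC h.isProperSupport

theorem IsActiveRep.sub_optValue_le_gap (hC : IsPolytope C) (hf : IsSmoothConvex C f)
    (h : IsActiveRep C α) : f (point α) - optValue C f ≤ gap C f α :=
  h.isProperSupport.sub_optValue_le hC.isCompact (hf.convex.subset (subset_univ C) hC.convex)
    hf.differentiable (h.point_mem hC.convex)

end ActiveRep

section Steps

variable {γ W K : ℝ} {α β : E →₀ ℝ} {n : ℕ}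

/-- The number of iterations in excess of the drop in the size of the active set. -/
def netSteps {V : Type*} (α : V →₀ ℝ) (n : ℕ) (β : V →₀ ℝ) : ℝ :=
  n - (α.support.card - β.support.card)

theorem netSteps_add {V : Type*} (α β β' : V →₀ ℝ) (m n : ℕ) :
    netSteps α (m + n) β' = netSteps α m β + netSteps β n β' := by
  simp only [netSteps, Nat.cast_add]
  ring

theorem netSteps_zero_self {V : Type*} (α : V →₀ ℝ) : netSteps α 0 α = 0 := by
  simp [netSteps]

theorem FracStep.isActiveRep (hα : IsActiveRep C α) (h : FracStep C f γ W α β) :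
    IsActiveRep C β := by
  obtain ⟨-, v, s, η, hv, hs, ⟨-, hη, rfl⟩ | ⟨-, hη, rfl⟩⟩ := h
  · exact hα.moveToward_frankWolfe hv.1 hη.1
  · rw [one_add_smul_sub_single]
    exact hα.moveToward_away hs.1 hη.1

theorem FracStep.apply_point_le (h : FracStep C f γ W α β) : f (point β) ≤ f (point α) := by
  obtain ⟨-, v, s, η, -, -, ⟨-, hη, rfl⟩ | ⟨-, hη, rfl⟩⟩ := h
  · rw [← moveToward, point_moveToward]
    exact hη.apply_le
  · rw [one_add_smul_sub_single, point_moveToward_neg]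
    exact hη.apply_le

theorem FracRun.isActiveRep (hα : IsActiveRep C α) (h : FracRun C f γ W α n β) :
    IsActiveRep C β := by
  induction h with
  | refl => exact hα
  | step _ hstep ih => exact hstep.isActiveRep ih

theorem FracRun.apply_point_le (h : FracRun C f γ W α n β) : f (point β) ≤ f (point α) := by
  induction h with
  | refl => exact le_rfl
  | step _ hstep ih => exact hstep.apply_point_le.trans ih

theorem FracStep.progress_or_card_lt (hC : IsPolytope C) (hf : ConvexOn ℝ univ f)
    (hK : AwayCurvatureLE C f K) (hW : 0 ≤ W) (hWK : Real.exp (-γ) * W / 2 ≤ K)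
    (hα : IsActiveRep C α) (h : FracStep C f γ W α β) :
    (β.support.card ≤ α.support.card + 1 ∧
      (Real.exp (-γ) * W / 2) ^ 2 ≤ 2 * K * (f (point α) - f (point β))) ∨
    β.support.card < α.support.card := by
  have hΓ : 0 ≤ Real.exp (-γ) * W / 2 := by positivity
  have hx : point α ∈ C := hα.point_mem hC.convex
  obtain ⟨hgap, v, s, η, hv, hs, ⟨hdir, hη, rfl⟩ | ⟨hdir, hη, rfl⟩⟩ := h
  · refine Or.inl ⟨card_support_moveToward_le α v η, ?_⟩
    rw [← moveToward, point_moveToward]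
    exact hK.sq_le_of_isMinOn hx (extremePoints_subset hv.1) hx hΓ hWK (by linarith)
      (hη.isMinOn_Icc_zero_one hf (Or.inl le_rfl))
  have hslope : fderiv ℝ f (point α) (point α - s) < -(Real.exp (-γ) * W / 2) := by
    rw [gap, supportGap_eq hs.1 hs.2 (extremePoints_subset hv.1) hv.2, map_sub] at hgap
    rw [map_sub] at hdir ⊢
    linarith
  have hs_ne_one : 1 - α s ≠ 0 := sub_ne_zero.2 fun hone => by
    rw [hα.point_eq_of_apply_eq_one hs.1 hone.symm, sub_self, map_zero] at hslope
    linarith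
  rw [one_add_smul_sub_single]
  rcases hη.1.2.lt_or_eq with hlt | rfl
  · refine Or.inl ⟨(Finset.card_le_card (support_moveToward_subset_of_mem hs.1 _)).trans
      (Nat.le_succ _), ?_⟩
    rw [point_moveToward_neg]
    exact hK.sq_le_of_isMinOn hx hx (extremePoints_subset (hα.extreme s hs.1)) hΓ hWK hslope.le
      (hη.isMinOn_Icc_zero_one hf (Or.inr hlt))
  · refine Or.inr (card_support_moveToward_lt hs.1 ?_)
    rw [moveToward_apply_self]
    field_simp
    ring

theorem FracStep.sq_mul_netSteps_le (hC : IsPolytope C) (hf : ConvexOn ℝ univ f)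
    (hK : AwayCurvatureLE C f K) (hW : 0 ≤ W) (hWK : Real.exp (-γ) * W / 2 ≤ K)
    (hα : IsActiveRep C α) (h : FracStep C f γ W α β) :
    W ^ 2 * netSteps α 1 β ≤ 16 * K * Real.exp (2 * γ) * (f (point α) - f (point β)) := by
  have hK₀ : 0 ≤ K := le_trans (by positivity) hWK
  have hdecrease : 0 ≤ f (point α) - f (point β) := sub_nonneg.2 h.apply_point_le
  rcases h.progress_or_card_lt hC hf hK hW hWK hα with ⟨hcard, hprogress⟩ | hcard
  · have hnet : netSteps α 1 β ≤ 2 := by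
      have : (β.support.card : ℝ) ≤ α.support.card + 1 := mod_cast hcard
      rw [netSteps, Nat.cast_one]
      linarith
    have hexp : Real.exp (2 * γ) * Real.exp (-γ) ^ 2 = 1 := by
      rw [← Real.exp_nat_mul, ← Real.exp_add]
      simp
    calc W ^ 2 * netSteps α 1 β ≤ W ^ 2 * 2 := by gcongr
      _ = 8 * Real.exp (2 * γ) * (Real.exp (-γ) * W / 2) ^ 2 := by
          linear_combination (-2 * W ^ 2) * hexp
      _ ≤ 8 * Real.exp (2 * γ) * (2 * K * (f (point α) - f (point β))) := by gcongr
      _ = 16 * K * Real.exp (2 * γ) * (f (point α) - f (point β)) := by ring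
  · have hnet : netSteps α 1 β ≤ 0 := by
      have : (β.support.card : ℝ) + 1 ≤ α.support.card := mod_cast hcard
      rw [netSteps, Nat.cast_one]
      linarith
    exact (mul_nonpos_of_nonneg_of_nonpos (sq_nonneg W) hnet).trans (by positivity)

theorem FracRun.sq_mul_netSteps_le (hC : IsPolytope C) (hf : ConvexOn ℝ univ f)
    (hK : AwayCurvatureLE C f K) (hW : 0 ≤ W) (hWK : Real.exp (-γ) * W / 2 ≤ K)
    (hα : IsActiveRep C α) (h : FracRun C f γ W α n β) :
    W ^ 2 * netSteps α n β ≤ 16 * K * Real.exp (2 * γ) * (f (point α) - f (point β)) := by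
  induction h with
  | refl => simp [netSteps_zero_self]
  | @step n β β' hrun hstep ih =>
    have hlast := hstep.sq_mul_netSteps_le hC hf hK hW hWK (hrun.isActiveRep hα)
    rw [netSteps_add α β β']
    linarith

theorem exists_isLineSearch (hf : Continuous f) (x d : E) {ηmax : ℝ} (hη : 0 ≤ ηmax) :
    ∃ η, IsLineSearch f x d ηmax η :=
  isCompact_Icc.exists_isMinOn (nonempty_Icc.2 hη) (Continuous.continuousOn (by fun_prop))

theorem exists_fracStep (hC : IsPolytope C) (hf : Continuous f) (hα : IsActiveRep C α)
    (h : Real.exp (-γ) * W < gap C f α) : ∃ β, FracStep C f γ W α β := by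
  obtain ⟨v, hv, hvmin⟩ := hC.exists_extremePoint_isMinOn (fderiv ℝ f (point α) : E →ₗ[ℝ] ℝ)
  obtain ⟨s, hs, hsmax⟩ := Finset.exists_max_image α.support (fun z => fderiv ℝ f (point α) z)
    hα.isProperSupport.nonempty
  rcases lt_or_ge (Real.exp (-γ) * W / 2) (-(fderiv ℝ f (point α) (v - point α))) with hdir | hdir
  · obtain ⟨η, hη⟩ := exists_isLineSearch hf (point α) (v - point α) zero_le_one
    exact ⟨_, h, v, s, η, ⟨hv, hvmin⟩, ⟨hs, hsmax⟩, Or.inl ⟨hdir, hη, rfl⟩⟩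
  · obtain ⟨η, hη⟩ := exists_isLineSearch hf (point α) (point α - s)
      (div_nonneg (hα.nonneg s) (sub_nonneg.2 (hα.le_one hs)))
    exact ⟨_, h, v, s, η, ⟨hv, hvmin⟩, ⟨hs, hsmax⟩, Or.inr ⟨hdir, hη, rfl⟩⟩

end Steps

section ErrorBounds

variable {δ θ c r μ : ℝ}

theorem Scaling.mul_sub_optValue_le (hS : Scaling C δ) (hC : IsPolytope C)
    (hf : ConvexOn ℝ univ f) (hd : Differentiable ℝ f) (hδ : 0 ≤ δ) (hx : x ∈ C) {y : E}
    (hy : y ∈ minimizers C f) :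
    δ * (f x - optValue C f) ≤ strongWolfeGap C f x * ‖x - y‖ := by
  by_cases hxmin : x ∈ minimizers C f
  · rw [optValue_eq hxmin, sub_self, mul_zero]
    exact mul_nonneg (strongWolfeGap_nonneg hC hx) (norm_nonneg _)
  have hxy : 0 < ‖x - y‖ := norm_sub_pos_iff.2 fun h => hxmin (h ▸ hy)
  have hscaling := hS f hf hd x ⟨hx, hxmin⟩ y hy
  rw [map_smul, smul_eq_mul] at hscaling
  calc δ * (f x - optValue C f) ≤ δ * fderiv ℝ f x (x - y) := by
        rw [optValue_eq hy]
        exact mul_le_mul_of_nonneg_left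
          (sub_le_fderiv_of_convexOn hf (mem_univ x) (mem_univ y) (hd x).hasFDerivAt) hδ
    _ = δ * (‖x - y‖⁻¹ * fderiv ℝ f x (x - y)) * ‖x - y‖ := by field_simp
    _ ≤ strongWolfeGap C f x * ‖x - y‖ := mul_le_mul_of_nonneg_right hscaling hxy.le

theorem le_rpow_one_div_one_sub {h a θ : ℝ} (hh : 0 ≤ h) (ha : 0 ≤ a) (hθ : θ < 1)
    (hle : h ≤ a * h ^ θ) : h ≤ a ^ (1 / (1 - θ)) := by
  rcases hh.eq_or_lt with rfl | hpos
  · positivity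
  have hθ' : 0 < 1 - θ := sub_pos.2 hθ
  have hpow : h ^ (1 - θ) ≤ a := by
    rwa [Real.rpow_sub hpos, Real.rpow_one, div_le_iff₀ (by positivity)]
  calc h = (h ^ (1 - θ)) ^ (1 / (1 - θ)) := by
        rw [← Real.rpow_mul hh, mul_one_div_cancel hθ'.ne', Real.rpow_one]
    _ ≤ a ^ (1 / (1 - θ)) := Real.rpow_le_rpow (by positivity) hpow (by positivity)

/-- The strong Wolfe primal bound `f x - f* ≤ μ w(x) ^ r`, the only consequence of the error bound
and of the geometry of `C` that enters the convergence rates. -/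
def WolfePrimalBound (C : Set E) (f : E → ℝ) (r μ : ℝ) : Prop :=
  ∀ x ∈ C, f x - optValue C f ≤ μ * strongWolfeGap C f x ^ r

theorem HEB.wolfePrimalBound (hH : HEB C f θ c) (hS : Scaling C δ) (hC : IsPolytope C)
    (hf : ConvexOn ℝ univ f) (hd : Differentiable ℝ f) (hθ : θ < 1) (hc : 0 ≤ c) (hδ : 0 < δ) :
    WolfePrimalBound C f (1 / (1 - θ)) ((c / δ) ^ (1 / (1 - θ))) := by
  intro x hx
  have hcont := hd.continuous.continuousOn (s := C)
  have hw := strongWolfeGap_nonneg (f := f) hC hx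
  obtain ⟨y, hy, hdist⟩ := (isCompact_minimizers hC.isCompact hcont).exists_infDist_eq_dist
    (minimizers_nonempty hC.isCompact ⟨x, hx⟩ hcont) x
  have herror : ‖x - y‖ ≤ c * (f x - optValue C f) ^ θ := by
    rw [← dist_eq_norm, ← hdist]
    exact hH x hx
  rw [← Real.mul_rpow (by positivity) hw]
  refine le_rpow_one_div_one_sub (sub_nonneg.2 (optValue_le hC.isCompact hcont hx))
    (by positivity) hθ ?_
  rw [div_mul_eq_mul_div, div_mul_eq_mul_div, le_div_iff₀ hδ]
  calc (f x - optValue C f) * δ ≤ strongWolfeGap C f x * ‖x - y‖ :=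
        (mul_comm _ _).trans_le (hS.mul_sub_optValue_le hC hf hd hδ.le hx hy)
    _ ≤ strongWolfeGap C f x * (c * (f x - optValue C f) ^ θ) := by gcongr
    _ = c * strongWolfeGap C f x * (f x - optValue C f) ^ θ := by ring

theorem WolfePrimalBound.le_gap (h : WolfePrimalBound C f r μ) (hC : IsPolytope C) (hr : 0 ≤ r)
    (hμ : 0 ≤ μ) {α : E →₀ ℝ} (hα : IsActiveRep C α) :
    f (point α) - optValue C f ≤ μ * gap C f α ^ r :=
  (h _ (hα.point_mem hC.convex)).trans <| mul_le_mul_of_nonneg_left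
    (Real.rpow_le_rpow (strongWolfeGap_nonneg hC (hα.point_mem hC.convex))
      (hα.strongWolfeGap_le_gap hC.isCompact) hr) hμ

theorem exists_heb_zero {X : Type*} [NormedAddCommGroup X] {D : Set X} {φ : X → ℝ}
    (hD : IsCompact D) (hφ : ContinuousOn φ D) : ∃ c : ℝ, 0 < c ∧ HEB D φ 0 c := by
  refine ⟨Metric.diam D + 1, add_pos_of_nonneg_of_pos Metric.diam_nonneg one_pos,
    fun x hx => ?_⟩
  obtain ⟨y, hy⟩ := minimizers_nonempty hD ⟨x, hx⟩ hφ
  rw [Real.rpow_zero, mul_one]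
  linarith [Metric.infDist_le_dist_of_mem (x := x) hy,
    Metric.dist_le_diam_of_mem hD.isBounded hx hy.1]

theorem mul_sq_norm_sub_le_of_strongConvexOn {m : ℝ} (hf : StrongConvexOn C m f) (hx : x ∈ C)
    {y : E} (hy : y ∈ minimizers C f) : m / 2 * ‖x - y‖ ^ 2 ≤ f x - f y := by
  have hsegment : ∀ b ∈ Ioo (0 : ℝ) 1, b * (m / 2 * ‖x - y‖ ^ 2) ≤ f x - f y := by
    intro b hb
    have ha : 0 < 1 - b := sub_pos.2 hb.2
    have hconvex := hf.2 hx hy.1 ha.le hb.1.le (sub_add_cancel 1 b)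
    have hmin : f y ≤ f ((1 - b) • x + b • y) :=
      hy.2 (hf.1 hx hy.1 ha.le hb.1.le (sub_add_cancel 1 b))
    simp only [smul_eq_mul] at hconvex
    refine le_of_mul_le_mul_left ?_ ha
    linarith
  have hlimit : Tendsto (fun b : ℝ => b * (m / 2 * ‖x - y‖ ^ 2)) (𝓝[<] 1)
      (𝓝 (1 * (m / 2 * ‖x - y‖ ^ 2))) :=
    ((continuous_id.mul continuous_const).tendsto 1).mono_left nhdsWithin_le_nhds
  rw [one_mul] at hlimit
  exact le_of_tendsto hlimit (Filter.mem_of_superset (Ioo_mem_nhdsLT one_pos) hsegment)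

theorem exists_heb_half_of_strongConvexOn (hC : IsCompact C) (hf : ContinuousOn f C) {m : ℝ}
    (hm : 0 < m) (hsc : StrongConvexOn C m f) : ∃ c : ℝ, 0 < c ∧ HEB C f (1 / 2) c := by
  refine ⟨√(2 / m), by positivity, fun x hx => ?_⟩
  obtain ⟨y, hy⟩ := minimizers_nonempty hC ⟨x, hx⟩ hf
  rw [← Real.sqrt_eq_rpow, ← Real.sqrt_mul (by positivity), optValue_eq hy]
  refine (Metric.infDist_le_dist_of_mem hy).trans (Real.le_sqrt_of_sq_le ?_)
  calc dist x y ^ 2 = 2 / m * (m / 2 * ‖x - y‖ ^ 2) := by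
        rw [dist_eq_norm]
        field_simp
    _ ≤ 2 / m * (f x - f y) := by
        gcongr
        exact mul_sq_norm_sub_le_of_strongConvexOn hsc hx hy

end ErrorBounds

section Restart

variable {γ ε W₀ K μ r : ℝ} {Φ : ℝ → ℝ} {α₀ α β : E →₀ ℝ} {T n : ℕ}

theorem RestartRun.isActiveRep (hα₀ : IsActiveRep C α₀) (h : RestartRun C f γ ε α₀ T α) :
    IsActiveRep C α := by
  induction h with
  | refl => exact hα₀
  | restart _ _ hout ih => exact hout.1.isActiveRep ih

theorem RestartRun.gap_le (hC : IsCompact C) (hγ : 0 ≤ γ) (hα₀ : IsActiveRep C α₀)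
    (h : RestartRun C f γ ε α₀ T α) : gap C f α ≤ gap C f α₀ := by
  induction h with
  | refl => exact le_rfl
  | restart hrun _ hout ih =>
    exact hout.2.trans ((mul_le_of_le_one_left ((hrun.isActiveRep hα₀).gap_nonneg hC)
      (Real.exp_le_one_iff.2 (neg_nonpos.2 hγ))).trans ih)

/-- A potential for the restart scheme: a call started at gap `w ∈ (0, W₀]` makes at most
`Φ (exp (-γ) * w) - Φ w` net steps, the growth of `Φ` when the gap shrinks to the target of the
call. -/
structure CallPotential (C : Set E) (f : E → ℝ) (γ W₀ : ℝ) (Φ : ℝ → ℝ) : Prop where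
  antitone : AntitoneOn Φ (Ioi 0)
  netSteps_le : ∀ ⦃α β : E →₀ ℝ⦄ ⦃n : ℕ⦄, IsActiveRep C α → 0 < gap C f α → gap C f α ≤ W₀ →
    FracRun C f γ (gap C f α) α n β →
      netSteps α n β ≤ Φ (Real.exp (-γ) * gap C f α) - Φ (gap C f α)

theorem FracRun.netSteps_le_mul_rpow (hC : IsPolytope C) (hf : IsSmoothConvex C f)
    (hK : AwayCurvatureLE C f K) (hP : WolfePrimalBound C f r μ) (hr : 0 ≤ r) (hμ : 0 ≤ μ)
    (hα : IsActiveRep C α) (hgap : 0 < gap C f α) (hburn : Real.exp (-γ) * gap C f α / 2 ≤ K)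
    (h : FracRun C f γ (gap C f α) α n β) :
    netSteps α n β ≤ 16 * Real.exp (2 * γ) * K * μ * gap C f α ^ (r - 2) := by
  have hK₀ : 0 ≤ K := le_trans (by positivity) hburn
  have hlower : optValue C f ≤ f (point β) :=
    optValue_le hC.isCompact hf.differentiable.continuous.continuousOn
      ((h.isActiveRep hα).point_mem hC.convex)
  have hupper := hP.le_gap hC hr hμ hα
  rw [Real.rpow_sub hgap, Real.rpow_two, ← mul_div_assoc, le_div_iff₀ (by positivity), mul_comm]
  calc gap C f α ^ 2 * netSteps α n β
      ≤ 16 * K * Real.exp (2 * γ) * (f (point α) - f (point β)) :=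
        h.sq_mul_netSteps_le hC hf.convex hK hgap.le hburn hα
    _ ≤ 16 * K * Real.exp (2 * γ) * (μ * gap C f α ^ r) := by gcongr; linarith
    _ = 16 * Real.exp (2 * γ) * K * μ * gap C f α ^ r := by ring

theorem WolfePrimalBound.callPotential_rpow (hP : WolfePrimalBound C f r μ) (hC : IsPolytope C)
    (hf : IsSmoothConvex C f) (hγ : 0 < γ) (hK : AwayCurvatureLE C f K) (hK₀ : 0 ≤ K)
    (hburn : Real.exp (-γ) * W₀ / 2 ≤ K) (hr : 0 ≤ r) (hr2 : r < 2) (hμ : 0 ≤ μ) :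
    CallPotential C f γ W₀ fun w =>
      16 * Real.exp (2 * γ) * K * μ / (Real.exp (γ * (2 - r)) - 1) * w ^ (r - 2) := by
  have hexp : 0 < Real.exp (γ * (2 - r)) - 1 :=
    sub_pos.2 (Real.one_lt_exp_iff.2 (mul_pos hγ (sub_pos.2 hr2)))
  refine ⟨fun a ha b _ hab => mul_le_mul_of_nonneg_left
    (Real.rpow_le_rpow_of_nonpos ha hab (by linarith)) (by positivity),
    fun α β n hα hgap hle h => ?_⟩
  refine (h.netSteps_le_mul_rpow hC hf hK hP hr hμ hα hgap
    (le_trans (by gcongr) hburn)).trans_eq ?_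
  rw [Real.mul_rpow (Real.exp_pos _).le hgap.le, ← Real.exp_mul,
    show -γ * (r - 2) = γ * (2 - r) by ring]
  field_simp

theorem WolfePrimalBound.callPotential_log (hP : WolfePrimalBound C f 2 μ) (hC : IsPolytope C)
    (hf : IsSmoothConvex C f) (hγ : 0 < γ) (hK : AwayCurvatureLE C f K) (hK₀ : 0 ≤ K)
    (hburn : Real.exp (-γ) * W₀ / 2 ≤ K) (hμ : 0 ≤ μ) :
    CallPotential C f γ W₀ fun w => -(16 * Real.exp (2 * γ) * K * μ / γ * Real.log w) := by
  refine ⟨fun a ha b _ hab => neg_le_neg (mul_le_mul_of_nonneg_left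
    (Real.log_le_log ha hab) (by positivity)), fun α β n hα hgap hle h => ?_⟩
  refine (h.netSteps_le_mul_rpow hC hf hK hP zero_le_two hμ hα hgap
    (le_trans (by gcongr) hburn)).trans_eq ?_
  rw [sub_self, Real.rpow_zero, Real.log_mul (Real.exp_pos _).ne' hgap.ne', Real.log_exp]
  field_simp
  ring

theorem CallPotential.netSteps_restartRun_le (hΦ : CallPotential C f γ W₀ Φ) (hC : IsCompact C)
    (hγ : 0 ≤ γ) (hα₀ : IsActiveRep C α₀) (hW₀ : gap C f α₀ ≤ W₀)
    (h : RestartRun C f γ ε α₀ T α) (hgap : 0 < gap C f α) :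
    netSteps α₀ T α ≤ Φ (gap C f α) - Φ (gap C f α₀) := by
  induction h with
  | refl => simp [netSteps_zero_self]
  | @restart T n α β hrun _ hout ih =>
    have hprev : 0 < gap C f α := pos_of_mul_pos_right (hgap.trans_le hout.2) (Real.exp_pos _).le
    have hcall := hΦ.netSteps_le (hrun.isActiveRep hα₀) hprev
      ((hrun.gap_le hC hγ hα₀).trans hW₀) hout.1
    have htarget : Φ (Real.exp (-γ) * gap C f α) ≤ Φ (gap C f β) :=
      hΦ.antitone hgap (mul_pos (Real.exp_pos _) hprev) hout.2
    rw [netSteps_add α₀ α β]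
    linarith [ih hprev]

theorem CallPotential.effectiveSteps_le (hΦ : CallPotential C f γ W₀ Φ) (hC : IsCompact C)
    (hγ : 0 ≤ γ) (hα₀ : IsActiveRep C α₀) (hW₀ : gap C f α₀ ≤ W₀)
    (h : RestartRun C f γ ε α₀ T α) (hgap : 0 < gap C f α) :
    effectiveSteps α₀ T α ≤ Φ (gap C f α) - Φ (gap C f α₀) := by
  have hle := h.gap_le hC hγ hα₀
  exact max_le (sub_nonneg.2 (hΦ.antitone hgap (hgap.trans_le hle) hle))
    (hΦ.netSteps_restartRun_le hC hγ hα₀ hW₀ h hgap)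

theorem CallPotential.iterations_sub_ncard_le (hΦ : CallPotential C f γ W₀ Φ)
    (hC : IsPolytope C) (hγ : 0 ≤ γ) (hα₀ : IsActiveRep C α₀) (hW₀ : gap C f α₀ ≤ W₀)
    (hrestart : RestartRun C f γ ε α₀ T α) (hgap : 0 < gap C f α)
    (hrun : FracRun C f γ (gap C f α) α n β) :
    ((T + n : ℕ) : ℝ) - (C.extremePoints ℝ).ncard ≤
      Φ (Real.exp (-γ) * gap C f α) - Φ (gap C f α₀) := by
  have hcalls := hΦ.netSteps_restartRun_le hC.isCompact hγ hα₀ hW₀ hrestart hgap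
  have hlast := hΦ.netSteps_le (hrestart.isActiveRep hα₀) hgap
    ((hrestart.gap_le hC.isCompact hγ hα₀).trans hW₀) hrun
  have hcard : (α₀.support.card : ℝ) ≤ (C.extremePoints ℝ).ncard :=
    mod_cast hα₀.card_le hC.finite_extremePoints
  have hnet : ((T + n : ℕ) : ℝ) - (C.extremePoints ℝ).ncard ≤ netSteps α₀ (T + n) β := by
    rw [netSteps]
    linarith [Nat.cast_nonneg (α := ℝ) β.support.card]
  rw [netSteps_add α₀ α β] at hnet
  linarith

end Restart

section OutputRates

variable {γ ε μ r : ℝ} {α₀ α : E →₀ ℝ} {T : ℕ}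

theorem le_mul_one_div_rpow {w w₀ X q : ℝ} (hw : 0 < w) (hw₀ : 0 < w₀) (hX : 0 < X) (hq : 0 < q)
    (h : X * w₀ ^ (-q) ≤ w ^ (-q)) : w ≤ w₀ * (1 / X ^ (1 / q)) := by
  rw [Real.rpow_neg hw₀.le, Real.rpow_neg hw.le, ← div_eq_mul_inv, ← one_div,
    div_le_div_iff₀ (by positivity) (by positivity), one_mul] at h
  rw [mul_one_div, le_div_iff₀ (by positivity)]
  calc w * X ^ (1 / q) = (X * w ^ q) ^ (1 / q) := by
        rw [Real.mul_rpow hX.le (by positivity), ← Real.rpow_mul hw.le,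
          mul_one_div_cancel hq.ne', Real.rpow_one, mul_comm]
    _ ≤ (w₀ ^ q) ^ (1 / q) := Real.rpow_le_rpow (by positivity) h (by positivity)
    _ = w₀ := by rw [← Real.rpow_mul hw₀.le, mul_one_div_cancel hq.ne', Real.rpow_one]

theorem le_mul_exp_of_le_log {w w₀ k s : ℝ} (hw : 0 < w) (hw₀ : 0 < w₀) (hk : 0 < k)
    (h : s ≤ k * (Real.log w₀ - Real.log w)) : w ≤ w₀ * Real.exp (-(s / k)) := by
  rw [← Real.log_le_log_iff hw (by positivity), Real.log_mul hw₀.ne' (Real.exp_pos _).ne',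
    Real.log_exp]
  linarith [(div_le_iff₀' hk).2 h]

theorem RestartRun.sub_optValue_le_of_lt_two (hC : IsPolytope C) (hf : IsSmoothConvex C f)
    (hγ : 0 < γ) (hP : WolfePrimalBound C f r μ) (hr : 0 ≤ r) (hr2 : r < 2) (hμ : 0 < μ)
    (hα₀ : IsActiveRep C α₀) (hburn : Real.exp (-γ) * gap C f α₀ / 2 ≤ awayCurvature C f)
    (h : RestartRun C f γ ε α₀ T α) :
    f (point α) - optValue C f ≤ gap C f α₀ * (1 / (1 + effectiveSteps α₀ T α *
      rateConst γ r (awayCurvature C f) μ (gap C f α₀)) ^ (1 / (2 - r))) := by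
  have hα := h.isActiveRep hα₀
  have hexp : 0 < Real.exp (γ * (2 - r)) - 1 :=
    sub_pos.2 (Real.one_lt_exp_iff.2 (mul_pos hγ (sub_pos.2 hr2)))
  have hsteps : 0 ≤ effectiveSteps α₀ T α := le_max_left _ _
  have hgap₀ := hα₀.gap_nonneg (f := f) hC.isCompact
  have hK₀ : 0 ≤ awayCurvature C f := le_trans (by positivity) hburn
  refine (hα.sub_optValue_le_gap hC hf).trans ?_
  rcases (hα.gap_nonneg (f := f) hC.isCompact).eq_or_lt with hzero | hgap
  · rw [← hzero, rateConst]
    positivity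
  have hpos : 0 < gap C f α₀ := hgap.trans_le (h.gap_le hC.isCompact hγ.le hα₀)
  have hK : 0 < awayCurvature C f := lt_of_lt_of_le (by positivity) hburn
  have hΦ := hP.callPotential_rpow hC hf hγ
    (awayCurvatureLE_awayCurvature hC.convex hC.isCompact.isBounded hf) hK₀ hburn hr hr2 hμ.le
  have hbound := hΦ.effectiveSteps_le hC.isCompact hγ.le hα₀ le_rfl h hgap
  rw [← mul_sub, div_mul_eq_mul_div, le_div_iff₀ hexp, mul_comm (16 * _ * _ * _),
    ← div_le_iff₀ (by positivity)] at hbound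
  refine le_mul_one_div_rpow hgap hpos (by rw [rateConst]; positivity) (sub_pos.2 hr2) ?_
  rw [neg_sub]
  calc (1 + effectiveSteps α₀ T α * rateConst γ r (awayCurvature C f) μ (gap C f α₀)) *
        gap C f α₀ ^ (r - 2)
      = gap C f α₀ ^ (r - 2) + effectiveSteps α₀ T α * (Real.exp (γ * (2 - r)) - 1) /
        (16 * Real.exp (2 * γ) * awayCurvature C f * μ) := by
        rw [rateConst]
        field_simp
    _ ≤ gap C f α ^ (r - 2) := by linarith

theorem RestartRun.sub_optValue_le_of_eq_two (hC : IsPolytope C) (hf : IsSmoothConvex C f)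
    (hγ : 0 < γ) (hP : WolfePrimalBound C f 2 μ) (hμ : 0 < μ) (hα₀ : IsActiveRep C α₀)
    (hburn : Real.exp (-γ) * gap C f α₀ / 2 ≤ awayCurvature C f)
    (h : RestartRun C f γ ε α₀ T α) :
    f (point α) - optValue C f ≤ gap C f α₀ * Real.exp (-(γ / Real.exp (2 * γ) *
      (effectiveSteps α₀ T α / (16 * awayCurvature C f * μ)))) := by
  have hα := h.isActiveRep hα₀
  refine (hα.sub_optValue_le_gap hC hf).trans ?_
  rcases (hα.gap_nonneg (f := f) hC.isCompact).eq_or_lt with hzero | hgap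
  · rw [← hzero]
    exact mul_nonneg (hα₀.gap_nonneg hC.isCompact) (Real.exp_pos _).le
  have hpos : 0 < gap C f α₀ := hgap.trans_le (h.gap_le hC.isCompact hγ.le hα₀)
  have hK : 0 < awayCurvature C f := lt_of_lt_of_le (by positivity) hburn
  have hΦ := hP.callPotential_log hC hf hγ
    (awayCurvatureLE_awayCurvature hC.convex hC.isCompact.isBounded hf) hK.le hburn hμ.le
  have hbound := hΦ.effectiveSteps_le hC.isCompact hγ.le hα₀ le_rfl h hgap
  have hexponent : γ / Real.exp (2 * γ) * (effectiveSteps α₀ T α / (16 * awayCurvature C f * μ)) =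
      effectiveSteps α₀ T α / (16 * Real.exp (2 * γ) * awayCurvature C f * μ / γ) := by
    field_simp
  rw [hexponent]
  exact le_mul_exp_of_le_log hgap hpos (by positivity) (by linarith)

end OutputRates

section IterateRates

variable {γ ε : ℝ} {α₀ α β : E →₀ ℝ} {T n t : ℕ}

theorem IsIterate.exists_fracRun (h : IsIterate C f γ ε α₀ t β) :
    ∃ (T n : ℕ) (α : E →₀ ℝ), t = T + n ∧ RestartRun C f γ ε α₀ T α ∧
      FracRun C f γ (gap C f α) α n β ∧ (0 < t → ε < strongWolfeGap C f (point α)) := by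
  rcases h with h | ⟨T, n, α, hrestart, hgap, hrun, ht⟩
  · cases h with
    | refl => exact ⟨0, 0, α₀, rfl, .refl, .refl, fun ht => absurd ht (lt_irrefl 0)⟩
    | @restart T n α _ hrestart hgap hout =>
      exact ⟨T, n, α, rfl, hrestart, hout.1, fun _ => hgap⟩
  · exact ⟨T, n, α, ht, hrestart, hrun, fun _ => hgap⟩

theorem FracRun.sub_optValue_le_gap (hC : IsPolytope C) (hf : IsSmoothConvex C f) {W : ℝ}
    (hα : IsActiveRep C α) (h : FracRun C f γ W α n β) :
    f (point β) - optValue C f ≤ gap C f α :=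
  (sub_le_sub_right h.apply_point_le _).trans (hα.sub_optValue_le_gap hC hf)

theorem exists_gap_le (hC : IsPolytope C) (hf : IsSmoothConvex C f) :
    ∃ B : ℝ, 0 ≤ B ∧ ∀ α, IsActiveRep C α → gap C f α ≤ B := by
  obtain ⟨L, hL⟩ := hf.smooth
  obtain ⟨B, hB⟩ := exists_fderiv_sub_le hC.isCompact
    (hL.continuousOn.mono (subset_add_sub_self C))
  obtain ⟨x, hx⟩ := hC.nonempty
  have hB₀ : 0 ≤ B := by simpa using hB x hx x hx x hx
  refine ⟨B, hB₀, fun α hα => Real.sSup_le ?_ hB₀⟩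
  rintro a ⟨y, hy, z, hz, rfl⟩
  exact hB _ (hα.point_mem hC.convex) _ (extremePoints_subset (hα.extreme y hy)) _ hz

theorem exists_awayCurvatureLE (hC : IsPolytope C) (hf : IsSmoothConvex C f) (hγ : 0 ≤ γ)
    {B : ℝ} (hB : 0 ≤ B) :
    ∃ K : ℝ, 0 < K ∧ AwayCurvatureLE C f K ∧ Real.exp (-γ) * B / 2 ≤ K := by
  have hbdd := hC.isCompact.isBounded
  have hnonneg := awayCurvature_nonneg hC.convex hbdd hC.nonempty hf
  refine ⟨awayCurvature C f + B + 1, by linarith,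
    (awayCurvatureLE_awayCurvature hC.convex hbdd hf).mono (by linarith), ?_⟩
  linarith [mul_le_of_le_one_left hB (Real.exp_le_one_iff.2 (neg_nonpos.2 hγ))]

theorem exists_wolfePrimalBound_one (hC : IsPolytope C) (hf : IsSmoothConvex C f) :
    ∃ μ : ℝ, 0 < μ ∧ WolfePrimalBound C f 1 μ := by
  obtain ⟨δ, hδ, hS⟩ := hC.exists_scaling
  obtain ⟨c, hc, hH⟩ := exists_heb_zero hC.isCompact hf.differentiable.continuous.continuousOn
  refine ⟨c / δ, div_pos hc hδ, ?_⟩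
  simpa only [sub_zero, div_one, Real.rpow_one] using
    hH.wolfePrimalBound hS hC hf.convex hf.differentiable one_pos hc.le hδ

theorem HEB.exists_wolfePrimalBound_two {c : ℝ} (hH : HEB C f (1 / 2) c) (hC : IsPolytope C)
    (hf : IsSmoothConvex C f) (hc : 0 < c) : ∃ μ : ℝ, 0 < μ ∧ WolfePrimalBound C f 2 μ := by
  obtain ⟨δ, hδ, hS⟩ := hC.exists_scaling
  refine ⟨(c / δ) ^ (2 : ℝ), Real.rpow_pos_of_pos (div_pos hc hδ) _, ?_⟩
  have hP := hH.wolfePrimalBound hS hC hf.convex hf.differentiable one_half_lt_one hc.le hδ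
  rwa [show (1 / (1 - 1 / 2) : ℝ) = 2 by norm_num] at hP

theorem exists_iterations_mul_gap_le (hC : IsPolytope C) (hf : IsSmoothConvex C f)
    (hγ : 0 < γ) :
    ∃ D : ℝ, 0 ≤ D ∧ ∀ (ε : ℝ) (α₀ α β : E →₀ ℝ) (T n : ℕ), IsActiveRep C α₀ →
      RestartRun C f γ ε α₀ T α → FracRun C f γ (gap C f α) α n β →
        (((T + n : ℕ) : ℝ) - (C.extremePoints ℝ).ncard) * gap C f α ≤ D := by
  obtain ⟨μ, hμ, hP⟩ := exists_wolfePrimalBound_one hC hf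
  obtain ⟨B, hB, hgapB⟩ := exists_gap_le hC hf
  obtain ⟨K, hK, hcurv, hburn⟩ := exists_awayCurvatureLE hC hf hγ.le hB
  set A := 16 * Real.exp (2 * γ) * K * μ / (Real.exp γ - 1) with hA_def
  have hA : 0 ≤ A :=
    div_nonneg (by positivity) (sub_nonneg.2 (Real.one_le_exp hγ.le))
  have hΦ : CallPotential C f γ B fun w => A * w ^ (-1 : ℝ) := by
    convert hP.callPotential_rpow hC hf hγ hcurv hK.le hburn zero_le_one one_lt_two hμ.le
      using 3 <;> norm_num [hA_def]
  refine ⟨A * Real.exp γ, by positivity, fun ε α₀ α β T n hα₀ hrestart hrun => ?_⟩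
  rcases ((hrestart.isActiveRep hα₀).gap_nonneg (f := f) hC.isCompact).eq_or_lt with hzero | hgap
  · rw [← hzero, mul_zero]
    positivity
  have hbound := hΦ.iterations_sub_ncard_le hC hγ.le hα₀ (hgapB α₀ hα₀) hrestart hgap hrun
  have hdrop : 0 ≤ A * gap C f α₀ ^ (-1 : ℝ) :=
    mul_nonneg hA (Real.rpow_nonneg (hα₀.gap_nonneg hC.isCompact) _)
  rw [Real.rpow_neg_one, mul_inv, ← Real.exp_neg, neg_neg, ← mul_assoc,
    ← div_eq_mul_inv] at hbound
  rw [← le_div_iff₀ hgap]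
  linarith

theorem exists_sublinear_rate (hC : IsPolytope C) (hf : IsSmoothConvex C f) (hγ : 0 < γ) :
    ∃ M : ℝ, ∀ (ε : ℝ) (α₀ : E →₀ ℝ), IsActiveRep C α₀ →
      ∀ t β, IsIterate C f γ ε α₀ t β → 0 < t → f (point β) - optValue C f ≤ M / t := by
  obtain ⟨D, -, hbound⟩ := exists_iterations_mul_gap_le hC hf hγ
  obtain ⟨B, -, hB⟩ := exists_gap_le hC hf
  refine ⟨D + (C.extremePoints ℝ).ncard * B, fun ε α₀ hα₀ t β h ht => ?_⟩
  obtain ⟨T, n, α, rfl, hrestart, hrun, -⟩ := h.exists_fracRun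
  have hα := hrestart.isActiveRep hα₀
  set N : ℝ := ((C.extremePoints ℝ).ncard : ℝ)
  have hN : 0 ≤ N := Nat.cast_nonneg _
  have hmul : ((T + n : ℕ) : ℝ) * gap C f α ≤ D + N * B := by
    linarith [hbound ε α₀ α β T n hα₀ hrestart hrun, mul_le_mul_of_nonneg_left (hB α hα) hN]
  rw [le_div_iff₀' (Nat.cast_pos.2 ht)]
  exact (mul_le_mul_of_nonneg_left (hrun.sub_optValue_le_gap hC hf hα)
    (Nat.cast_nonneg _)).trans hmul

theorem HEB.exists_linear_rate {c : ℝ} (hH : HEB C f (1 / 2) c) (hC : IsPolytope C)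
    (hf : IsSmoothConvex C f) (hγ : 0 < γ) (hc : 0 < c) :
    ∃ M ρ : ℝ, 0 < ρ ∧ ρ < 1 ∧ ∀ (ε : ℝ) (α₀ : E →₀ ℝ), IsActiveRep C α₀ →
      ∀ t β, IsIterate C f γ ε α₀ t β → f (point β) - optValue C f ≤ M * ρ ^ t := by
  obtain ⟨μ, hμ, hP⟩ := hH.exists_wolfePrimalBound_two hC hf hc
  obtain ⟨B, hB, hgapB⟩ := exists_gap_le hC hf
  obtain ⟨K, hK, hcurv, hburn⟩ := exists_awayCurvatureLE hC hf hγ.le hB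
  have hΦ := hP.callPotential_log hC hf hγ hcurv hK.le hburn hμ.le
  set k := 16 * Real.exp (2 * γ) * K * μ / γ
  have hk : 0 < k := by positivity
  set N : ℝ := ((C.extremePoints ℝ).ncard : ℝ)
  refine ⟨B * Real.exp (γ + N / k), Real.exp (-(1 / k)), Real.exp_pos _,
    Real.exp_lt_one_iff.2 (neg_lt_zero.2 (by positivity)), fun ε α₀ hα₀ t β h => ?_⟩
  have hdecay : B * Real.exp (γ + N / k) * Real.exp (-(1 / k)) ^ t =
      Real.exp γ * (B * Real.exp (-((t - N) / k))) := by
    rw [← Real.exp_nat_mul, mul_left_comm, ← Real.exp_add, mul_assoc, ← Real.exp_add]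
    ring_nf
  rw [hdecay]
  obtain ⟨T, n, α, rfl, hrestart, hrun, -⟩ := h.exists_fracRun
  have hα := hrestart.isActiveRep hα₀
  refine (hrun.sub_optValue_le_gap hC hf hα).trans ?_
  rcases (hα.gap_nonneg (f := f) hC.isCompact).eq_or_lt with hzero | hgap
  · rw [← hzero]
    positivity
  have hbound := hΦ.iterations_sub_ncard_le hC hγ.le hα₀ (hgapB α₀ hα₀) hrestart hgap hrun
  have hpos : 0 < gap C f α₀ := hgap.trans_le (hrestart.gap_le hC.isCompact hγ.le hα₀)
  have hshrunk : Real.exp (-γ) * gap C f α ≤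
      gap C f α₀ * Real.exp (-((((T + n : ℕ) : ℝ) - N) / k)) :=
    le_mul_exp_of_le_log (by positivity) hpos hk (by linarith)
  rw [Real.exp_neg γ, inv_mul_le_iff₀ (Real.exp_pos γ)] at hshrunk
  refine hshrunk.trans ?_
  gcongr
  exact hgapB α₀ hα₀

end IterateRates

section Termination

variable {γ ε : ℝ} {α₀ α β : E →₀ ℝ} {T n N : ℕ}

theorem FracOutput.pos (hγ : 0 < γ) (hgap : 0 < gap C f α) (h : FracOutput C f γ α n β) :
    0 < n := by
  refine Nat.pos_of_ne_zero ?_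
  rintro rfl
  obtain ⟨hrun, hle⟩ := h
  cases hrun
  exact (mul_lt_of_lt_one_left hgap (Real.exp_lt_one_iff.2 (neg_lt_zero.2 hγ))).not_ge hle

theorem exists_fracOutput_or_exists_fracRun (hC : IsPolytope C) (hf : Continuous f)
    (hα : IsActiveRep C α) (n : ℕ) :
    (∃ k β, FracOutput C f γ α k β) ∨ ∃ β, FracRun C f γ (gap C f α) α n β := by
  induction n with
  | zero => exact Or.inr ⟨α, FracRun.refl⟩
  | succ n ih =>
    rcases ih with hout | ⟨β, hrun⟩
    · exact Or.inl hout
    rcases le_or_gt (gap C f β) (Real.exp (-γ) * gap C f α) with hle | hgt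
    · exact Or.inl ⟨n, β, hrun, hle⟩
    · obtain ⟨β', hstep⟩ := exists_fracStep hC hf (hrun.isActiveRep hα) hgt
      exact Or.inr ⟨β', hrun.step hstep⟩

theorem RestartRun.exists_fracOutput (hC : IsPolytope C) (hf : Continuous f)
    (hα₀ : IsActiveRep C α₀) (hN : ∀ t β, IsIterate C f γ ε α₀ t β → t ≤ N)
    (h : RestartRun C f γ ε α₀ T α) (hgap : ε < strongWolfeGap C f (point α)) :
    ∃ n β, FracOutput C f γ α n β := by
  refine (exists_fracOutput_or_exists_fracRun hC hf (h.isActiveRep hα₀) (N + 1)).resolve_right ?_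
  rintro ⟨β, hrun⟩
  have := hN _ β (Or.inr ⟨T, N + 1, α, h, hgap, hrun, rfl⟩)
  omega

theorem exists_isOutput (hC : IsPolytope C) (hf : Continuous f) (hγ : 0 < γ) (hε : 0 ≤ ε)
    (hα₀ : IsActiveRep C α₀) (hN : ∀ t β, IsIterate C f γ ε α₀ t β → t ≤ N) :
    ∃ T α, IsOutput C f γ ε α₀ T α := by
  by_contra! hnone
  have hlong : ∀ k : ℕ, ∃ T α, k ≤ T ∧ RestartRun C f γ ε α₀ T α := by
    intro k
    induction k with
    | zero => exact ⟨0, α₀, le_rfl, RestartRun.refl⟩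
    | succ k ih =>
      obtain ⟨T, α, hkT, hrun⟩ := ih
      have hgap : ε < strongWolfeGap C f (point α) :=
        not_le.1 fun hle => hnone T α ⟨hrun, hle⟩
      obtain ⟨n, β, hout⟩ := hrun.exists_fracOutput hC hf hα₀ hN hgap
      have hn := hout.pos hγ ((hε.trans_lt hgap).trans_le
        ((hrun.isActiveRep hα₀).strongWolfeGap_le_gap hC.isCompact))
      exact ⟨T + n, β, by omega, hrun.restart hgap hout⟩
  obtain ⟨T, α, hNT, hrun⟩ := hlong (N + 1)
  have := hN T α (Or.inl hrun)
  omega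

theorem exists_iterations_le (hC : IsPolytope C) (hf : IsSmoothConvex C f) (hγ : 0 < γ)
    (hε : 0 < ε) :
    ∃ N : ℕ, ∀ α₀, IsActiveRep C α₀ → ∀ t β, IsIterate C f γ ε α₀ t β → t ≤ N := by
  obtain ⟨D, hD, hbound⟩ := exists_iterations_mul_gap_le hC hf hγ
  obtain ⟨N, hN⟩ := exists_nat_ge ((C.extremePoints ℝ).ncard + D / ε)
  refine ⟨N, fun α₀ hα₀ t β h => ?_⟩
  rcases t.eq_zero_or_pos with rfl | ht
  · exact N.zero_le
  obtain ⟨T, n, α, rfl, hrestart, hrun, hgap⟩ := h.exists_fracRun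
  have hε_gap : ε < gap C f α :=
    (hgap ht).trans_le ((hrestart.isActiveRep hα₀).strongWolfeGap_le_gap hC.isCompact)
  have hle : ((T + n : ℕ) : ℝ) - (C.extremePoints ℝ).ncard ≤ D / ε :=
    calc ((T + n : ℕ) : ℝ) - (C.extremePoints ℝ).ncard
        ≤ D / gap C f α :=
          (le_div_iff₀ (hε.trans hε_gap)).2 (hbound ε α₀ α β T n hα₀ hrestart hrun)
      _ ≤ D / ε := by gcongr
  exact_mod_cast (sub_le_iff_le_add'.1 hle).trans hN

end Termination

end RestartFW

theorem mainTheorem4_general {E : Type*} [NormedAddCommGroup E] [NormedSpace ℝ E]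
    (C : Set E) (hC : IsPolytope C) (f : E → ℝ) (hf : IsSmoothConvex C f)
    (γ : ℝ) (hγ : 0 < γ) :
    (∃ δ : ℝ, 0 < δ ∧ Scaling C δ) ∧
    (∀ ε : ℝ, 0 < ε → ∃ N : ℕ, ∀ α₀ : E →₀ ℝ, IsActiveRep C α₀ →
      (∀ t α, IsIterate C f γ ε α₀ t α → t ≤ N) ∧ ∃ T α, IsOutput C f γ ε α₀ T α) ∧
    (∀ θ c δ r μ : ℝ, 0 < c → 0 < δ → HEB C f θ c → Scaling C δ →
      r = 1 / (1 - θ) → μ = (c / δ) ^ r →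
      ∀ (ε : ℝ) (α₀ : E →₀ ℝ), IsActiveRep C α₀ →
      Real.exp (-γ) * gap C f α₀ / 2 ≤ awayCurvature C f →
      ∀ T α, RestartRun C f γ ε α₀ T α →
        (0 < r → r < 2 →
          f (point α) - optValue C f ≤
            gap C f α₀ * (1 / (1 + effectiveSteps α₀ T α *
              rateConst γ r (awayCurvature C f) μ (gap C f α₀)) ^ (1 / (2 - r)))) ∧
        (r = 2 →
          f (point α) - optValue C f ≤
            gap C f α₀ * Real.exp (-(γ / Real.exp (2 * γ) *
              (effectiveSteps α₀ T α / (16 * awayCurvature C f * μ)))))) ∧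
    (∀ m : ℝ, 0 < m → StrongConvexOn C m f →
      (∃ c : ℝ, 0 < c ∧ HEB C f (1 / 2) c) ∧
      ∃ M ρ : ℝ, 0 < ρ ∧ ρ < 1 ∧
        ∀ (ε : ℝ) (α₀ : E →₀ ℝ), IsActiveRep C α₀ →
        ∀ t α, IsIterate C f γ ε α₀ t α → f (point α) - optValue C f ≤ M * ρ ^ t) ∧
    ((∃ c : ℝ, 0 < c ∧ HEB C f 0 c) ∧
      ∃ M : ℝ, ∀ (ε : ℝ) (α₀ : E →₀ ℝ), IsActiveRep C α₀ →
        ∀ t α, IsIterate C f γ ε α₀ t α → 0 < t → f (point α) - optValue C f ≤ M / t) := by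
  have hcont : ContinuousOn f C := hf.differentiable.continuous.continuousOn
  refine ⟨hC.exists_scaling, fun ε hε => ?_, ?_, fun m hm hsc => ?_,
    exists_heb_zero hC.isCompact hcont, exists_sublinear_rate hC hf hγ⟩
  · obtain ⟨N, hN⟩ := exists_iterations_le hC hf hγ hε
    exact ⟨N, fun α₀ hα₀ => ⟨hN α₀ hα₀,
      exists_isOutput hC hf.differentiable.continuous hγ hε.le hα₀ (hN α₀ hα₀)⟩⟩
  · rintro θ c δ r _ hc hδ hH hS hr rfl ε α₀ hα₀ hburn T α hrun
    have hμ : 0 < (c / δ) ^ r := Real.rpow_pos_of_pos (div_pos hc hδ) r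
    have hP (hr0 : 0 < r) : WolfePrimalBound C f r ((c / δ) ^ r) := by
      have hθ : θ < 1 := sub_pos.1 (one_div_pos.1 (hr ▸ hr0))
      exact hr ▸ hH.wolfePrimalBound hS hC hf.convex hf.differentiable hθ hc.le hδ
    refine ⟨fun hr0 hr2 =>
      hrun.sub_optValue_le_of_lt_two hC hf hγ (hP hr0) hr0.le hr2 hμ hα₀ hburn, fun hr2 => ?_⟩
    exact hrun.sub_optValue_le_of_eq_two hC hf hγ
      (by simpa only [hr2] using hP (hr2 ▸ two_pos)) hμ hα₀ hburn
  · obtain ⟨c, hc, hH⟩ := exists_heb_half_of_strongConvexOn hC.isCompact hcont hm hsc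
    exact ⟨⟨c, hc, hH⟩, hH.exists_linear_rate hC hf hγ hc⟩

theorem mainTheorem4 {E : Type*} [NormedAddCommGroup E] [NormedSpace ℝ E] [FiniteDimensional ℝ E]
    (C : Set E) (hC : IsPolytope C) (f : E → ℝ) (hf : IsSmoothConvex C f)
    (γ : ℝ) (hγ : 0 < γ) :
    -- a polytope satisfies a scaling inequality
    (∃ δ : ℝ, 0 < δ ∧ Scaling C δ) ∧
    -- the restart scheme terminates, from every starting point
    (∀ ε : ℝ, 0 < ε → ∃ N : ℕ, ∀ α₀ : E →₀ ℝ, IsActiveRep C α₀ →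
      (∀ t α, IsIterate C f γ ε α₀ t α → t ≤ N) ∧ ∃ T α, IsOutput C f γ ε α₀ T α) ∧
    -- rates of the output under the Hölderian error bound, after the burn-in phase
    (∀ θ c δ r μ : ℝ, 0 ≤ θ → θ ≤ 1 → 0 < c → 0 < δ → HEB C f θ c → Scaling C δ →
      r = 1 / (1 - θ) → μ = (c / δ) ^ r →
      ∀ ε : ℝ, 0 < ε → ∀ α₀ : E →₀ ℝ, IsActiveRep C α₀ →
      Real.exp (-γ) * gap C f α₀ / 2 ≤ awayCurvature C f →
      ∀ T α, IsOutput C f γ ε α₀ T α →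
        (1 ≤ r → r < 2 →
          f (point α) - optValue C f ≤
            gap C f α₀ * (1 / (1 + effectiveSteps α₀ T α *
              rateConst γ r (awayCurvature C f) μ (gap C f α₀)) ^ (1 / (2 - r)))) ∧
        (r = 2 →
          f (point α) - optValue C f ≤
            gap C f α₀ * Real.exp (-(γ / Real.exp (2 * γ) *
              (effectiveSteps α₀ T α / (16 * awayCurvature C f * μ)))))) ∧
    -- strongly convex objective: the error bound holds with exponent 1/2, and convergence is linear
    (∀ m : ℝ, 0 < m → StrongConvexOn C m f →
      (∃ c : ℝ, 0 < c ∧ HEB C f (1 / 2) c) ∧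
      ∃ M ρ : ℝ, 0 < ρ ∧ ρ < 1 ∧
        ∀ ε : ℝ, 0 < ε → ∀ α₀ : E →₀ ℝ, IsActiveRep C α₀ →
        ∀ t α, IsIterate C f γ ε α₀ t α → f (point α) - optValue C f ≤ M * ρ ^ t) ∧
    -- general smooth convex objective: the error bound holds with exponent 0, and the rate is O(1/t)
    ((∃ c : ℝ, 0 < c ∧ HEB C f 0 c) ∧
      ∃ M : ℝ, ∀ ε : ℝ, 0 < ε → ∀ α₀ : E →₀ ℝ, IsActiveRep C α₀ →
        ∀ t α, IsIterate C f γ ε α₀ t α → 0 < t → f (point α) - optValue C f ≤ M / t) := by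
  obtain ⟨hscaling, hterm, hrate, hstrong, hheb, M, hM⟩ := mainTheorem4_general C hC f hf γ hγ
  refine ⟨hscaling, hterm, ?_, fun m hm hsc => ?_, hheb, M, fun ε _ => hM ε⟩
  · intro θ c δ r μ _ _ hc hδ hH hS hr hμ ε _ α₀ hα₀ hburn T α hout
    exact (hrate θ c δ r μ hc hδ hH hS hr hμ ε α₀ hα₀ hburn T α hout.1).imp_left
      fun h hr1 => h (one_pos.trans_le hr1)
  · obtain ⟨hhalf, M, ρ, hρ0, hρ1, hM⟩ := hstrong m hm hsc
    exact ⟨hhalf, M, ρ, hρ0, hρ1, fun ε _ => hM ε⟩
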